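/- The universality problem for one-clock timed visibly one-counter automata (with zero tests allowed) is undecidable. That is: there is no algorithm that, given a finite description of a one-clock timed visibly one-counter automaton $\mathcal{A}$ over a finite input alphabet $\Sigma$, decides whether $L(\mathcal{A})=T\Sigma^+$. Here $T\Sigma^+$ is the set of timed words over $\Sigma$, i.e. of non-empty finite sequences $(a_1,t_1)\dots(a_n,t_n)\in(\Sigma\times\mathbb{R}_{\ge 0})^+$ with $t_1\le\dots\le t_n$. A *timed pushdown automaton* $\mathcal{A}=(\Sigma,\Gamma,\mathcal{L},\mathcal{L}_0,\mathcal{L}_f,\mathcal{X},E)$ consists of a finite input alphabet $\Sigma$, a finite stack alphabet $\Gamma$, a finite set $\mathcal{L}$ of locations, sets $\mathcal{L}_0,\mathcal{L}_f\subseteq\mathcal{L}$ of initial and accepting locations, a finite set $\mathcal{X}$ of clocks, and a finite set $E$ of edges $(\ell,a,\phi,\mathsf{op},\lambda,\ell')$ with $\ell,\ell'\in\mathcal{L}$, $a\in\Sigma$, $\phi$ a finite (possibly empty) conjunction of constraints $x\sim c$ with $x\in\mathcal{X}$, $c\in\mathbb{N}$, ${\sim}\in\{<,\le,=,\ge,>\}$,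 $\mathsf{op}\in\{pop(\gamma),push(\gamma)\mid\gamma\in\Gamma\}\cup\{noop,empty?\}$ and $\lambda\subseteq\mathcal{X}$. From a state $(\ell,\nu,u)\in\mathcal{L}\times\mathbb{R}_{\ge 0}^{\mathcal{X}}\times\Gamma^*$ it may let time $\delta\ge 0$ elapse and take such an edge, reading $a$, if $\nu+\delta$ satisfies $\phi$ and $\mathsf{op}$ is enabled: $pop(\gamma)$ requires $\gamma$ on top of the stack and removes it, $push(\gamma)$ puts $\gamma$ on top, $empty?$ requires the empty stack, and $noop$ and $empty?$ leave the stack unchanged. The new location is $\ell'$ and the new clock values are those of $\nu+\delta$, except that the clocks in $\lambda$ are set to $0$. $L(\mathcal{A})$ is the set of timed words $(a_1,\delta_1)(a_2,\delta_1+\delta_2)\dots(a_n,\delta_1+\dots+\delta_n)$ for which $\mathcal{A}$ has a run with delays $\delta_i$ and letters $a_i$ that starts in an initial location with all clocks $0$ and empty stack, and ends in an accepting location. The automaton is *one-clock* if $|\mathcal{X}|=1$, *one-counter* if $|\Gamma|=1$, and *visibly* if $\Sigma$ is the disjoint union of (possibly empty) sets $\Sigma_{\mathsf{int}},\Sigma_{\mathsf{call}},\Sigma_{\mathsf{ret}}$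 such that for every edge: $a\in\Sigma_{\mathsf{int}}$ iff $\mathsf{op}=noop$; $a\in\Sigma_{\mathsf{call}}$ iff $\mathsf{op}$ is a push; $a\in\Sigma_{\mathsf{ret}}$ iff $\mathsf{op}$ is $empty?$ or a pop. -/

import Mathlib

open scoped NNReal

namespace TimedAutomata

/-- The set `TΣ⁺` of timed words over `A`: non-empty finite sequences of pairs (letter, timestamp)
whose timestamps are non-negative reals in non-decreasing order. -/
def timedWords (A : Type) : Set (List (A × ℝ≥0)) :=
  {w | w ≠ [] ∧ (w.map Prod.snd).Pairwise (· ≤ ·)}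

/-- The comparison symbols `<`, `≤`, `=`, `≥`, `>`. -/
inductive Cmp where
  | lt | le | eq | ge | gt

def Cmp.holds : Cmp → ℝ≥0 → ℕ → Prop
  | .lt, r, c => r < c
  | .le, r, c => r ≤ c
  | .eq, r, c => r = c
  | .ge, r, c => (c : ℝ≥0) ≤ r
  | .gt, r, c => (c : ℝ≥0) < r

/-- A clock constraint is a finite conjunction of atoms `x ∼ c` with `c ∈ ℕ`; the empty conjunction
is `true`. -/
abbrev ClockConstraint (X : Type) : Type := List (X × Cmp × ℕ)

def ClockConstraint.Sat {X : Type} (φ : ClockConstraint X) (ν : X → ℝ≥0) : Prop :=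
  ∀ p ∈ φ, p.2.1.holds (ν p.1) p.2.2

/-- The stack operations over the stack alphabet `G`. -/
inductive StackOp (G : Type) where
  | pop (g : G)
  | push (g : G)
  | noop
  | emptyTest

/-- `op.Acts u u'`: the operation `op` is enabled at the stack content `u` (top of the stack is the
head of the list) and turns it into `u'`. -/
def StackOp.Acts {G : Type} : StackOp G → List G → List G → Prop
  | .pop g, u, u' => u = g :: u'
  | .push g, u, u' => u' = g :: u
  | .noop, u, u' => u' = u
  | .emptyTest, u, u' => u = [] ∧ u' = []

def StackOp.map {G H : Type} (f : G → H) : StackOp G → StackOp H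
  | .pop g => .pop (f g)
  | .push g => .push (f g)
  | .noop => .noop
  | .emptyTest => .emptyTest

/-- An edge `(l, a, φ, op, λ, l')`. -/
structure Edge (A G Q X : Type) where
  source : Q
  letter : A
  guard : ClockConstraint X
  op : StackOp G
  reset : Set X
  target : Q

/-- A timed pushdown automaton with finite input alphabet `A`, finite stack alphabet `G`, finite set
of locations `Q`, finite set of clocks `X` and finitely many edges. -/
structure TimedPushdownAutomaton (A G Q X : Type) [Finite A] [Finite G] [Finite Q] [Finite X] where
  init : Set Q
  accept : Set Q
  edges : Set (Edge A G Q X)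
  edges_finite : edges.Finite

/-- A state `(l, ν, u)`: location, clock valuation, stack content. -/
structure State (G Q X : Type) where
  loc : Q
  val : X → ℝ≥0
  stack : List G

/-- The timed word associated with a sequence of pairs (delay, letter) that begins at time `t`. -/
def timestamps {A : Type} : ℝ≥0 → List (ℝ≥0 × A) → List (A × ℝ≥0)
  | _, [] => []
  | t, (d, a) :: r => (a, t + d) :: timestamps (t + d) r

namespace TimedPushdownAutomaton

variable {A G Q X : Type} [Finite A] [Finite G] [Finite Q] [Finite X]

/-- The transition relation: first the delay `d` elapses, then an edge reading `a` is taken. -/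
def Step (M : TimedPushdownAutomaton A G Q X) (s : State G Q X) (d : ℝ≥0) (a : A)
    (s' : State G Q X) : Prop :=
  ∃ e ∈ M.edges, e.source = s.loc ∧ e.letter = a ∧ e.target = s'.loc ∧
    e.guard.Sat (fun x => s.val x + d) ∧
    (∀ x, (x ∈ e.reset → s'.val x = 0) ∧ (x ∉ e.reset → s'.val x = s.val x + d)) ∧
    e.op.Acts s.stack s'.stack

/-- `M.Run s r s'`: there is a run from `s` to `s'` with the sequence `r` of delays and letters. -/
inductive Run (M : TimedPushdownAutomaton A G Q X) :
    State G Q X → List (ℝ≥0 × A) → State G Q X → Prop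
  | nil (s : State G Q X) : Run M s [] s
  | cons {s s' s'' : State G Q X} {d : ℝ≥0} {a : A} {r : List (ℝ≥0 × A)} :
      M.Step s d a s' → Run M s' r s'' → Run M s ((d, a) :: r) s''

/-- The timed words associated with successful runs: those that start in an initial location with
all clocks zero and the empty stack, and end in an accepting location. -/
def language (M : TimedPushdownAutomaton A G Q X) : Set (List (A × ℝ≥0)) :=
  {w | w ∈ timedWords A ∧ ∃ (s s' : State G Q X) (r : List (ℝ≥0 × A)),
    s.loc ∈ M.init ∧ (∀ x, s.val x = 0) ∧ s.stack = [] ∧ M.Run s r s' ∧ s'.loc ∈ M.accept ∧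
    timestamps 0 r = w}

def IsUniversal (M : TimedPushdownAutomaton A G Q X) : Prop :=
  M.language = timedWords A

/-- The automaton has exactly one clock. -/
def IsOneClock (_ : TimedPushdownAutomaton A G Q X) : Prop := Nat.card X = 1

/-- The stack alphabet is a singleton; zero tests are allowed. -/
def IsOneCounter (_ : TimedPushdownAutomaton A G Q X) : Prop := Nat.card G = 1

/-- The input alphabet can be partitioned into three (possibly empty) sets of internal, call and
return symbols that determine the kind of stack operation. -/
def IsVisibly (M : TimedPushdownAutomaton A G Q X) : Prop :=
  ∃ internal call ret : Set A,
    internal ∪ call ∪ ret = Set.univ ∧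
    Disjoint internal call ∧ Disjoint internal ret ∧ Disjoint call ret ∧
    ∀ e ∈ M.edges,
      (e.letter ∈ internal ↔ e.op = .noop) ∧
      (e.letter ∈ call ↔ ∃ g, e.op = .push g) ∧
      (e.letter ∈ ret ↔ e.op = .emptyTest ∨ ∃ g, e.op = .pop g)

end TimedPushdownAutomaton

/-! Finite descriptions of automata as inputs of algorithms: the letters, stack symbols, locations
and clocks are numbered, and sets are given by lists. -/

/-- The description of an edge. -/
structure EdgeCode where
  source : ℕ
  letter : ℕ
  guard : List (ℕ × Cmp × ℕ)
  op : StackOp ℕ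
  reset : List ℕ
  target : ℕ

/-- The description of a timed pushdown automaton: the sizes of the input alphabet, of the stack
alphabet, of the set of locations and of the set of clocks; the initial locations, the accepting
locations and the edges. -/
structure AutomatonCode where
  letters : ℕ
  stackSymbols : ℕ
  locations : ℕ
  clocks : ℕ
  init : List ℕ
  accept : List ℕ
  edges : List EdgeCode

/-- `r.Describes e`: the numbers in `r` are the indices of the components of `e`. -/
def EdgeCode.Describes {k g m n : ℕ} (r : EdgeCode)
    (e : Edge (Fin k) (Fin g) (Fin m) (Fin n)) : Prop :=
  r.source = e.source ∧ r.letter = e.letter ∧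
    r.guard = e.guard.map (fun p => (p.1.val, p.2)) ∧
    r.op = e.op.map Fin.val ∧
    (∀ x : Fin n, x ∈ e.reset ↔ (x : ℕ) ∈ r.reset) ∧ r.target = e.target

theorem EdgeCode.Describes.unique {k g m n : ℕ} {r : EdgeCode}
    {e e' : Edge (Fin k) (Fin g) (Fin m) (Fin n)} (h : r.Describes e) (h' : r.Describes e') :
    e = e' := by
  obtain ⟨s, a, φ, o, R, t⟩ := e
  obtain ⟨s', a', φ', o', R', t'⟩ := e'
  obtain ⟨h1, h2, h3, h4, h5, h6⟩ := h
  obtain ⟨k1, k2, k3, k4, k5, k6⟩ := h'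
  simp only at h1 h2 h3 h4 h5 h6 k1 k2 k3 k4 k5 k6
  have e1 : s = s' := Fin.ext (h1.symm.trans k1)
  have e2 : a = a' := Fin.ext (h2.symm.trans k2)
  have e6 : t = t' := Fin.ext (h6.symm.trans k6)
  have e5 : R = R' := Set.ext fun x => (h5 x).trans (k5 x).symm
  have e3 : φ = φ' := by
    refine List.map_injective_iff.2 ?_ (h3.symm.trans k3)
    rintro ⟨x, p⟩ ⟨y, q⟩ hxy
    simp only [Prod.mk.injEq] at hxy
    exact Prod.ext (Fin.ext hxy.1) hxy.2
  have e4 : o = o' := by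
    have h := h4.symm.trans k4
    cases o <;> cases o' <;> simp_all [StackOp.map, Fin.ext_iff]
  subst e1 e2 e3 e4 e5 e6
  rfl

/-- The automaton described by `c`. An edge of `c` that refers to a letter, a stack symbol, a
location or (in its guard) a clock that does not exist is ignored. -/
def AutomatonCode.toAutomaton (c : AutomatonCode) :
    TimedPushdownAutomaton (Fin c.letters) (Fin c.stackSymbols) (Fin c.locations)
      (Fin c.clocks) where
  init := {l | (l : ℕ) ∈ c.init}
  accept := {l | (l : ℕ) ∈ c.accept}
  edges := {e | ∃ r ∈ c.edges, r.Describes e}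
  edges_finite := by
    classical
    have h : (⋃ r ∈ {r | r ∈ c.edges},
        {e : Edge (Fin c.letters) (Fin c.stackSymbols) (Fin c.locations) (Fin c.clocks) |
          r.Describes e}).Finite :=
      (List.finite_toSet c.edges).biUnion fun r _ =>
        Set.Subsingleton.finite fun _ he _ he' => EdgeCode.Describes.unique he he'
    refine h.subset ?_
    rintro e ⟨r, hr, he⟩
    exact Set.mem_biUnion (show r ∈ {r | r ∈ c.edges} from hr) he

/-! The numberings of descriptions by natural numbers that computability refers to. -/

def Cmp.equivFin : Cmp ≃ Fin 5 where
  toFun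
    | .lt => 0
    | .le => 1
    | .eq => 2
    | .ge => 3
    | .gt => 4
  invFun
    | 0 => .lt
    | 1 => .le
    | 2 => .eq
    | 3 => .ge
    | 4 => .gt
  left_inv := by intro x; cases x <;> rfl
  right_inv := by intro x; fin_cases x <;> rfl

def StackOp.equivSum : StackOp ℕ ≃ (ℕ ⊕ ℕ) ⊕ Bool where
  toFun
    | .pop g => .inl (.inl g)
    | .push g => .inl (.inr g)
    | .noop => .inr false
    | .emptyTest => .inr true
  invFun
    | .inl (.inl g) => .pop g
    | .inl (.inr g) => .push g
    | .inr false => .noop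
    | .inr true => .emptyTest
  left_inv := by intro x; cases x <;> rfl
  right_inv := by rintro ((g | g) | (_ | _)) <;> rfl

instance : Primcodable Cmp := Primcodable.ofEquiv _ Cmp.equivFin

instance : Primcodable (StackOp ℕ) := Primcodable.ofEquiv _ StackOp.equivSum

def EdgeCode.equivProd :
    EdgeCode ≃ ℕ × ℕ × List (ℕ × Cmp × ℕ) × StackOp ℕ × List ℕ × ℕ where
  toFun e := (e.source, e.letter, e.guard, e.op, e.reset, e.target)
  invFun p := ⟨p.1, p.2.1, p.2.2.1, p.2.2.2.1, p.2.2.2.2.1, p.2.2.2.2.2⟩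
  left_inv _ := rfl
  right_inv _ := rfl

instance : Primcodable EdgeCode := Primcodable.ofEquiv _ EdgeCode.equivProd

def AutomatonCode.equivProd :
    AutomatonCode ≃ ℕ × ℕ × ℕ × ℕ × List ℕ × List ℕ × List EdgeCode where
  toFun c := (c.letters, c.stackSymbols, c.locations, c.clocks, c.init, c.accept, c.edges)
  invFun p := ⟨p.1, p.2.1, p.2.2.1, p.2.2.2.1, p.2.2.2.2.1, p.2.2.2.2.2.1, p.2.2.2.2.2.2⟩
  left_inv _ := rfl
  right_inv _ := rfl

instance : Primcodable AutomatonCode := Primcodable.ofEquiv _ AutomatonCode.equivProd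

end TimedAutomata

/-! The halting problem reduces to non-universality: the automaton guesses a defect of its input, so
the words that it rejects are those without defects, and such words exist iff a given Turing machine
halts.

A computation is written as consecutive rows of `n` cells, so that the letter `n` places further on
is the same cell one step later; in time it is placed exactly one unit later. With one clock, reset
at a guessed letter, it can be detected that no correct copy follows after one time unit, that two
letters share a time, or that two neighbouring letters do not fit. What one clock cannot detect is
an inserted letter that is the copy of nothing.

The counter excludes insertions. A defect-free word consists of calls, then internal letters, then
returns: say `n` calls, `m` internal letters and at most `n` returns, since a return on the empty
stack is a defect. Sending each call or internal letter to its copy is strictly increasing, and no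
copy is a call, so `p` goes to `p + n` or beyond. At most `n + m` positions remain after the calls,
so `p` goes to `p + n` exactly and there is no room for an insertion. This is
`exists_isSpiral_of_good`; `IsSpiral.exists_good` is the converse.

The calls spell the initial configuration with a variable amount of blank padding, the internal
letters carry the computation, and the returns only supply copies for the last row.
`IsCellSpiral.exists_halted` and `exists_isCellSpiral` relate such spirals to halting. A machine
with a finite state set and an undecidable halting problem comes from `exists_undecidable_machine`,
and `primrec_code` makes the reduction computable. -/

namespace TimedAutomata

/-! ### A one-clock one-counter automaton that searches for defects -/

/-- The data of a family of one-clock visibly one-counter automata. `kind a` is `0` for calls, `1` for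
internal letters and any other number for returns. -/
structure Checker where
  letters : ℕ
  kind : ℕ → ℕ
  first : ℕ → Bool
  halt : ℕ → Bool
  next : ℕ → ℕ → Bool
  copy : ℕ → ℕ → Bool

namespace Checker

variable (C : Checker)

/-- The stack operations available on a letter of the given kind. -/
def ops : ℕ → List (StackOp ℕ)
  | 0 => [.push 0]
  | 1 => [.noop]
  | _ => [.pop 0, .emptyTest]

/-- The edges reading `a`, as (source, guard, reset, target); `b` is a remembered letter. -/
def rules (a b : ℕ) : List (ℕ × List (ℕ × Cmp × ℕ) × List ℕ × ℕ) :=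
  -- Location `0` tests the first letter, `1` is the accepting sink, `2` scans for a defect, `3`
  -- survives as long as no halting letter occurs. In `4 + 2 * b` the letter `b` has just been read
  -- and the next letter is tested against it; in `5 + 2 * b` the run survives unless a correct copy
  -- of `b` comes with clock value exactly `1`.
  [(1, [], [], 1), (2, [], [], 2), (2, [], [0], 4 + 2 * a), (4 + 2 * b, [(0, .eq, 0)], [], 1),
    (5 + 2 * b, [(0, .lt, 1)], [], 5 + 2 * b), (5 + 2 * b, [(0, .gt, 1)], [], 5 + 2 * b)] ++
  ((bif C.first a then [] else [(0, [], [], 1)]) ++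
  ((bif C.halt a then [] else [(3, [], [], 3)]) ++
  ((bif decide (C.kind a < 2) then [(2, [], [0], 5 + 2 * a)] else []) ++
  ((bif C.next b a then [] else [(4 + 2 * b, [], [], 1)]) ++
  (bif C.copy b a then [] else [(5 + 2 * b, [], [], 5 + 2 * b)])))))

/-- The additional edge recognizes the one defect that concerns the counter: a return read on the
empty stack. -/
def edges : List EdgeCode :=
  (List.range C.letters).flatMap fun a =>
    ((List.range C.letters).flatMap fun b => (C.rules a b).flatMap fun r =>
      (ops (C.kind a)).map fun o => ⟨r.1, a, r.2.1, o, r.2.2.1, r.2.2.2⟩) ++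
    (bif decide (C.kind a < 2) then [] else [⟨2, a, [], .emptyTest, [], 1⟩])

/-- The locations `5 + 2 * a` accept because a word that ends before a copy of `a` arrives lacks it;
the locations `4 + 2 * a` do not, because the last letter has no successor that could be wrong. -/
def code : AutomatonCode where
  letters := C.letters
  stackSymbols := 1
  locations := 4 + 2 * C.letters
  clocks := 1
  init := [0, 2, 3]
  accept := 1 :: 3 :: (List.range C.letters).map fun a => 5 + 2 * a
  edges := C.edges

/-- The height of the stack after reading a letter of the given kind. -/
def height : ℕ → ℕ → ℕ
  | 0, h => h + 1
  | 1, h => h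
  | _, h => h - 1

/-- The effect of a stack operation on the height of the stack. -/
def opActs : StackOp ℕ → ℕ → ℕ → Prop
  | .pop g, h, h' => g = 0 ∧ h = h' + 1
  | .push g, h, h' => g = 0 ∧ h' = h + 1
  | .noop, h, h' => h' = h
  | .emptyTest, h, h' => h = 0 ∧ h' = 0

/-- On a return exactly one of pop and zero test is enabled. Hence the rules never block on the
stack, and its height depends only on the word. -/
theorem exists_ops_iff (k h h' : ℕ) : (∃ o ∈ ops k, opActs o h h') ↔ h' = height k h := by
  match k with
  | 0 => simp [ops, opActs, height]
  | 1 => simp [ops, opActs, height]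
  | k + 2 => simp [ops, opActs, height]; omega

/-- The state with the given location, clock value and stack height. -/
def st {L : ℕ} (l : Fin L) (x : ℝ≥0) (h : ℕ) : State (Fin 1) (Fin L) (Fin 1) :=
  ⟨l, fun _ => x, List.replicate h 0⟩

theorem exists_eq_st {L : ℕ} (s : State (Fin 1) (Fin L) (Fin 1)) : ∃ l x h, s = st l x h := by
  obtain ⟨l, v, u⟩ := s
  refine ⟨l, v 0, u.length, ?_⟩
  simp only [st, State.mk.injEq, true_and]
  refine ⟨funext fun i => by rw [Subsingleton.elim i 0], ?_⟩
  exact List.eq_replicate_of_mem fun b _ => Subsingleton.elim _ _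

theorem acts_iff (o : StackOp (Fin 1)) (h h' : ℕ) :
    o.Acts (List.replicate h 0) (List.replicate h' 0) ↔ opActs (o.map Fin.val) h h' := by
  have key : ∀ (g : Fin 1) (m n : ℕ),
      List.replicate m 0 = g :: List.replicate n 0 ↔ m = n + 1 := by
    intro g m n
    rw [Subsingleton.elim g 0, ← List.replicate_succ]
    constructor
    · intro e; simpa using congrArg List.length e
    · rintro rfl; rfl
  have key' : ∀ m n : ℕ, List.replicate m (0 : Fin 1) = List.replicate n 0 ↔ m = n := by
    intro m n
    constructor
    · intro e; simpa using congrArg List.length e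
    · rintro rfl; rfl
  cases o with
  | pop g => simp [StackOp.Acts, StackOp.map, opActs, key]
  | push g => simp [StackOp.Acts, StackOp.map, opActs, key]
  | noop => simp [StackOp.Acts, StackOp.map, opActs, key']
  | emptyTest => simp [StackOp.Acts, StackOp.map, opActs]

theorem exists_map_of_opActs {o : StackOp ℕ} {h h' : ℕ} (H : opActs o h h') :
    ∃ o' : StackOp (Fin 1), o = o'.map Fin.val := by
  cases o with
  | pop g => exact ⟨.pop 0, by simp [StackOp.map, H.1]⟩
  | push g => exact ⟨.push 0, by simp [StackOp.map, H.1]⟩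
  | noop => exact ⟨.noop, rfl⟩
  | emptyTest => exact ⟨.emptyTest, rfl⟩

def GuardHolds (φ : List (ℕ × Cmp × ℕ)) (x : ℝ≥0) : Prop :=
  ∀ p ∈ φ, p.1 = 0 ∧ p.2.1.holds x p.2.2

theorem step_iff (K L : ℕ) (i f : List ℕ) (E : List EdgeCode) (l l' : Fin L) (x x' d : ℝ≥0)
    (h h' : ℕ) (a : Fin K) :
    (AutomatonCode.toAutomaton ⟨K, 1, L, 1, i, f, E⟩).Step (st l x h) d a (st l' x' h') ↔
      ∃ r ∈ E, r.source = l ∧ r.letter = a ∧ r.target = l' ∧ GuardHolds r.guard (x + d) ∧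
        ((0 ∈ r.reset → x' = 0) ∧ (0 ∉ r.reset → x' = x + d)) ∧ opActs r.op h h' := by
  constructor
  · rintro ⟨e, ⟨r, hr, h1, h2, h3, h4, h5, h6⟩, rfl, rfl, e3, e4, e5, e6⟩
    refine ⟨r, hr, h1, h2, h6.trans (congrArg Fin.val e3), ?_, ?_, ?_⟩
    · rw [h3]
      intro p hp
      obtain ⟨q, hq, rfl⟩ := List.mem_map.1 hp
      exact ⟨by simp [Subsingleton.elim q.1 0], e4 q hq⟩
    · have := e5 0
      rw [h5 0] at this
      exact this
    · rw [h4]; exact (acts_iff _ _ _).1 e6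
  · rintro ⟨r, hr, h1, h2, h3, h4, h5, h6⟩
    obtain ⟨o, ho⟩ := exists_map_of_opActs h6
    refine ⟨⟨l, a, r.guard.map fun p => (0, p.2), o, {y | (y : ℕ) ∈ r.reset}, l'⟩,
      ⟨r, hr, h1, h2, ?_, ho, fun _ => Iff.rfl, h3⟩, rfl, rfl, rfl, ?_, ?_, ?_⟩
    · simp only [List.map_map]
      symm
      refine (List.map_congr_left (g := id) fun p hp => ?_).trans (List.map_id _)
      obtain ⟨p1, p2⟩ := p
      have := (h4 _ hp).1
      simp_all
    · intro p hp
      obtain ⟨q, hq, rfl⟩ := List.mem_map.1 hp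
      exact (h4 q hq).2
    · intro y
      rw [Subsingleton.elim y 0]
      exact h5
    · exact (acts_iff _ _ _).2 (ho ▸ h6)

/-- Acceptance from location `l`, clock value `x` and stack height `h`. -/
def Acc : ℕ → ℝ≥0 → ℕ → List (ℝ≥0 × ℕ) → Prop
  | l, _, _, [] => l ∈ C.code.accept
  | l, x, h, (d, a) :: r => ∃ e ∈ C.edges, e.source = l ∧ e.letter = a ∧
      GuardHolds e.guard (x + d) ∧ ∃ h', opActs e.op h h' ∧
        Acc e.target (if 0 ∈ e.reset then 0 else x + d) h' r

theorem target_lt_of_mem_rules {a b : ℕ} (ha : a < C.letters) (hb : b < C.letters)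
    {r : ℕ × List (ℕ × Cmp × ℕ) × List ℕ × ℕ} (hr : r ∈ C.rules a b) :
    r.2.2.2 < 4 + 2 * C.letters := by
  simp only [rules, List.mem_append, List.mem_cons, List.not_mem_nil, or_false] at hr
  rcases hr with (rfl | rfl | rfl | rfl | rfl | rfl) | hr | hr | hr | hr | hr
  · simp only; omega
  · simp only; omega
  · simp only; omega
  · simp only; omega
  · simp only; omega
  · simp only; omega
  · cases h : C.first a <;> simp [h] at hr; subst hr; simp only; omega
  · cases h : C.halt a <;> simp [h] at hr; subst hr; simp only; omega
  · by_cases h : C.kind a < 2 <;> simp [h] at hr; subst hr; simp only; omega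
  · cases h : C.next b a <;> simp [h] at hr; subst hr; simp only; omega
  · cases h : C.copy b a <;> simp [h] at hr; subst hr; simp only; omega

theorem mem_edges {e : EdgeCode} : e ∈ C.edges ↔ ∃ a < C.letters,
    (∃ b < C.letters, ∃ r ∈ C.rules a b, ∃ o ∈ ops (C.kind a),
      e = ⟨r.1, a, r.2.1, o, r.2.2.1, r.2.2.2⟩) ∨
    (2 ≤ C.kind a ∧ e = ⟨2, a, [], .emptyTest, [], 1⟩) := by
  simp only [edges, List.mem_flatMap, List.mem_range, List.mem_append, List.mem_map]
  refine exists_congr fun a => and_congr_right fun _ => or_congr ?_ ?_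
  · simp only [eq_comm]
  · by_cases h : C.kind a < 2
    · simp [h]
    · simp [h, not_lt.1 h]

theorem target_lt_of_mem_edges {e : EdgeCode} (he : e ∈ C.edges) :
    e.target < 4 + 2 * C.letters := by
  obtain ⟨a, ha, ⟨b, hb, r, hr, o, -, rfl⟩ | ⟨-, rfl⟩⟩ := C.mem_edges.1 he
  · exact C.target_lt_of_mem_rules ha hb hr
  · simp only; omega

theorem acc_iff_run (l : Fin (4 + 2 * C.letters)) (x : ℝ≥0) (h : ℕ)
    (r : List (ℝ≥0 × Fin C.letters)) :
    (∃ s', C.code.toAutomaton.Run (st l x h) r s' ∧ s'.loc ∈ C.code.toAutomaton.accept) ↔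
      C.Acc l x h (r.map fun p => (p.1, p.2.val)) := by
  induction r generalizing l x h with
  | nil =>
    constructor
    · rintro ⟨s', ⟨⟩, h2⟩
      exact h2
    · intro h1
      exact ⟨_, .nil _, h1⟩
  | cons p r ih =>
    obtain ⟨d, a⟩ := p
    simp only [List.map_cons, Acc]
    constructor
    · rintro ⟨s', ⟨⟩, h2⟩
      rename_i s1 hs hr
      obtain ⟨l', x', h', rfl⟩ := exists_eq_st s1
      obtain ⟨e, he, e1, e2, e3, e4, ⟨e5, e5'⟩, e6⟩ :=
        (step_iff C.letters (4 + 2 * C.letters) _ _ C.edges l l' x x' d h h' a).1 hs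
      refine ⟨e, he, e1, e2, e4, h', e6, ?_⟩
      have := (ih l' x' h').1 ⟨_, hr, h2⟩
      rw [e3]
      split_ifs with h0
      · rwa [e5 h0] at this
      · rwa [e5' h0] at this
    · rintro ⟨e, he, e1, e2, e4, h', e6, e7⟩
      have := (ih ⟨e.target, C.target_lt_of_mem_edges he⟩ _ h').2 e7
      obtain ⟨s', hr, h2⟩ := this
      refine ⟨s', .cons ?_ hr, h2⟩
      refine (step_iff C.letters (4 + 2 * C.letters) _ _ C.edges l _ x _ d h h' a).2
        ⟨e, he, e1, e2, rfl, e4, ⟨fun h0 => if_pos h0, fun h0 => if_neg h0⟩, e6⟩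

theorem acc_cons {l : ℕ} {x d : ℝ≥0} {h a : ℕ} {r : List (ℝ≥0 × ℕ)} (ha : a < C.letters) :
    C.Acc l x h ((d, a) :: r) ↔
      (∃ b < C.letters, ∃ e ∈ C.rules a b, e.1 = l ∧ GuardHolds e.2.1 (x + d) ∧
        C.Acc e.2.2.2 (if 0 ∈ e.2.2.1 then 0 else x + d) (height (C.kind a) h) r) ∨
      (2 ≤ C.kind a ∧ l = 2 ∧ h = 0 ∧ C.Acc 1 (x + d) 0 r) := by
  rw [Acc]
  constructor
  · rintro ⟨e, he, rfl, rfl, h1, h', h2, h3⟩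
    obtain ⟨a, ha, ⟨b, hb, r, hr, o, ho, rfl⟩ | ⟨hk, rfl⟩⟩ := C.mem_edges.1 he
    · refine Or.inl ⟨b, hb, r, hr, rfl, h1, ?_⟩
      rw [← (exists_ops_iff (C.kind a) h h').1 ⟨o, ho, h2⟩]
      exact h3
    · obtain ⟨rfl, rfl⟩ := h2
      exact Or.inr ⟨hk, rfl, rfl, h3⟩
  · rintro (⟨b, hb, e, he, rfl, h1, h2⟩ | ⟨hk, rfl, rfl, h1⟩)
    · obtain ⟨o, ho, ho'⟩ := (exists_ops_iff (C.kind a) h _).2 rfl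
      exact ⟨_, C.mem_edges.2 ⟨a, ha, Or.inl ⟨b, hb, e, he, o, ho, rfl⟩⟩, rfl, rfl, h1, _, ho', h2⟩
    · exact ⟨_, C.mem_edges.2 ⟨a, ha, Or.inr ⟨hk, rfl⟩⟩, rfl, rfl, by simp [GuardHolds], 0,
        ⟨rfl, rfl⟩, h1⟩

theorem exists_rules_iff {a b l : ℕ} (P : List (ℕ × Cmp × ℕ) → List ℕ → ℕ → Prop) :
    (∃ e ∈ C.rules a b, e.1 = l ∧ P e.2.1 e.2.2.1 e.2.2.2) ↔
      (l = 1 ∧ P [] [] 1) ∨ (l = 2 ∧ P [] [] 2) ∨ (l = 2 ∧ P [] [0] (4 + 2 * a)) ∨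
      (l = 4 + 2 * b ∧ P [(0, .eq, 0)] [] 1) ∨
      (l = 5 + 2 * b ∧ P [(0, .lt, 1)] [] (5 + 2 * b)) ∨
      (l = 5 + 2 * b ∧ P [(0, .gt, 1)] [] (5 + 2 * b)) ∨
      (l = 0 ∧ C.first a = false ∧ P [] [] 1) ∨
      (l = 3 ∧ C.halt a = false ∧ P [] [] 3) ∨
      (l = 2 ∧ C.kind a < 2 ∧ P [] [0] (5 + 2 * a)) ∨
      (l = 4 + 2 * b ∧ C.next b a = false ∧ P [] [] 1) ∨
      (l = 5 + 2 * b ∧ C.copy b a = false ∧ P [] [] (5 + 2 * b)) := by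
  cases h1 : C.first a <;> cases h2 : C.halt a <;> by_cases h3 : C.kind a < 2 <;>
    cases h4 : C.next b a <;> cases h5 : C.copy b a <;>
    simp [rules, h1, h2, h3, h4, h5, @eq_comm _ l]

@[simp] theorem guardHolds_nil (x : ℝ≥0) : GuardHolds [] x := by simp [GuardHolds]

@[simp] theorem guardHolds_single (s : Cmp) (c : ℕ) (x : ℝ≥0) :
    GuardHolds [(0, s, c)] x ↔ s.holds x c := by simp [GuardHolds]

/-! ### What is accepted from each location -/

variable {C}

theorem acc_cons_iff {l : ℕ} {x d : ℝ≥0} {h a : ℕ} {r : List (ℝ≥0 × ℕ)} (ha : a < C.letters) :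
    C.Acc l x h ((d, a) :: r) ↔ (∃ b < C.letters,
      (l = 1 ∧ C.Acc 1 (x + d) (height (C.kind a) h) r) ∨
      (l = 2 ∧ C.Acc 2 (x + d) (height (C.kind a) h) r) ∨
      (l = 2 ∧ C.Acc (4 + 2 * a) 0 (height (C.kind a) h) r) ∨
      (l = 4 + 2 * b ∧ x + d = 0 ∧ C.Acc 1 (x + d) (height (C.kind a) h) r) ∨
      (l = 5 + 2 * b ∧ x + d < 1 ∧ C.Acc (5 + 2 * b) (x + d) (height (C.kind a) h) r) ∨
      (l = 5 + 2 * b ∧ 1 < x + d ∧ C.Acc (5 + 2 * b) (x + d) (height (C.kind a) h) r) ∨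
      (l = 0 ∧ C.first a = false ∧ C.Acc 1 (x + d) (height (C.kind a) h) r) ∨
      (l = 3 ∧ C.halt a = false ∧ C.Acc 3 (x + d) (height (C.kind a) h) r) ∨
      (l = 2 ∧ C.kind a < 2 ∧ C.Acc (5 + 2 * a) 0 (height (C.kind a) h) r) ∨
      (l = 4 + 2 * b ∧ C.next b a = false ∧ C.Acc 1 (x + d) (height (C.kind a) h) r) ∨
      (l = 5 + 2 * b ∧ C.copy b a = false ∧
        C.Acc (5 + 2 * b) (x + d) (height (C.kind a) h) r)) ∨
      (2 ≤ C.kind a ∧ l = 2 ∧ h = 0 ∧ C.Acc 1 (x + d) 0 r) := by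
  rw [C.acc_cons ha]
  refine or_congr (exists_congr fun b => and_congr_right fun _ => ?_) Iff.rfl
  have key := C.exists_rules_iff (a := a) (b := b) (l := l)
    (P := fun g s t => GuardHolds g (x + d) ∧
        C.Acc t (if 0 ∈ s then 0 else x + d) (height (C.kind a) h) r)
  simpa only [guardHolds_nil, guardHolds_single, Cmp.holds, List.mem_singleton,
    List.not_mem_nil, if_true, if_false, true_and, Nat.cast_zero, Nat.cast_one] using key

theorem acc_nil {l : ℕ} {x : ℝ≥0} {h : ℕ} :
    C.Acc l x h [] ↔ l = 1 ∨ l = 3 ∨ ∃ a < C.letters, l = 5 + 2 * a := by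
  simp [Acc, code, eq_comm]

/-- All letters of a sequence belong to the alphabet. -/
def Valid (C : Checker) (r : List (ℝ≥0 × ℕ)) : Prop := ∀ p ∈ r, p.2 < C.letters

theorem acc_sink {x : ℝ≥0} {h : ℕ} {r : List (ℝ≥0 × ℕ)} (hr : C.Valid r) : C.Acc 1 x h r := by
  induction r generalizing x h with
  | nil => simp [acc_nil]
  | cons p r ih =>
    have ha := hr p (by simp)
    exact (acc_cons_iff ha).2 (Or.inl ⟨_, ha, Or.inl ⟨rfl, ih fun q hq => hr q (by simp [hq])⟩⟩)

theorem acc_start {x d : ℝ≥0} {h a : ℕ} {r : List (ℝ≥0 × ℕ)} (ha : a < C.letters)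
    (hr : C.Valid r) : C.Acc 0 x h ((d, a) :: r) ↔ C.first a = false := by
  have e4 : ∀ b, ¬ 0 = 4 + 2 * b := by omega
  have e5 : ∀ b, ¬ 0 = 5 + 2 * b := by omega
  simp only [acc_cons_iff ha, e4, e5, acc_sink hr]
  simp only [false_and, false_or, true_and, and_true, or_false, and_false,
    OfNat.zero_ne_ofNat, zero_ne_one]
  exact ⟨fun ⟨_, _, h⟩ => h, fun h => ⟨a, ha, h⟩⟩

theorem acc_noHalt {x : ℝ≥0} {h : ℕ} {r : List (ℝ≥0 × ℕ)} (hr : C.Valid r) :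
    C.Acc 3 x h r ↔ ∀ p ∈ r, C.halt p.2 = false := by
  have e4 : ∀ b, ¬ 3 = 4 + 2 * b := by omega
  have e5 : ∀ b, ¬ 3 = 5 + 2 * b := by omega
  induction r generalizing x h with
  | nil => simp [acc_nil]
  | cons p r ih =>
    obtain ⟨d, a⟩ := p
    have ha : a < C.letters := hr _ (List.mem_cons_self ..)
    simp only [acc_cons_iff ha, e4, e5, ih fun q hq => hr q (List.mem_cons_of_mem _ hq)]
    simp only [List.forall_mem_cons, OfNat.ofNat_ne_one, OfNat.ofNat_ne_zero, Nat.reduceEqDiff,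
      false_and, false_or, or_false, true_and, and_false]
    exact ⟨fun ⟨_, _, h⟩ => h, fun h => ⟨a, ha, h⟩⟩

theorem acc_next {x d : ℝ≥0} {b h a : ℕ} {r : List (ℝ≥0 × ℕ)} (ha : a < C.letters)
    (hb : b < C.letters) (hr : C.Valid r) :
    C.Acc (4 + 2 * b) x h ((d, a) :: r) ↔ x + d = 0 ∨ C.next b a = false := by
  have e0 : ¬ 4 + 2 * b = 0 := by omega
  have e1 : ¬ 4 + 2 * b = 1 := by omega
  have e2 : ¬ 4 + 2 * b = 2 := by omega
  have e3 : ¬ 4 + 2 * b = 3 := by omega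
  have e4 : ∀ c, 4 + 2 * b = 4 + 2 * c ↔ b = c := by omega
  have e5 : ∀ c, ¬ 4 + 2 * b = 5 + 2 * c := by omega
  simp only [acc_cons_iff ha, e0, e1, e2, e3, e4, e5, acc_sink hr, false_and, false_or, or_false,
    and_true, and_false]
  constructor
  · rintro ⟨c, -, ⟨rfl, h⟩ | ⟨rfl, h⟩⟩
    · exact Or.inl h
    · exact Or.inr h
  · rintro (h | h)
    · exact ⟨b, hb, Or.inl ⟨rfl, h⟩⟩
    · exact ⟨b, hb, Or.inr ⟨rfl, h⟩⟩

theorem not_acc_next_nil {x : ℝ≥0} {b h : ℕ} : ¬ C.Acc (4 + 2 * b) x h [] := by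
  rw [acc_nil]; omega

/-- Here `T` is the time of the last reset, so that the clock shows `1` exactly at the timestamp `T
+ 1`. Letters at other times pass by the strict guards. -/
theorem acc_copy {T x : ℝ≥0} {b h : ℕ} {r : List (ℝ≥0 × ℕ)} (hb : b < C.letters)
    (hr : C.Valid r) : C.Acc (5 + 2 * b) x h r ↔
      ∀ p ∈ timestamps (T + x) r, p.2 = T + 1 → C.copy b p.1 = false := by
  have e0 : ¬ 5 + 2 * b = 0 := by omega
  have e1 : ¬ 5 + 2 * b = 1 := by omega
  have e2 : ¬ 5 + 2 * b = 2 := by omega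
  have e3 : ¬ 5 + 2 * b = 3 := by omega
  have e4 : ∀ c, ¬ 5 + 2 * b = 4 + 2 * c := by omega
  have e5 : ∀ c, 5 + 2 * b = 5 + 2 * c ↔ b = c := by omega
  induction r generalizing x h with
  | nil => simp only [acc_nil, e5, timestamps]; simp [hb]
  | cons p r ih =>
    obtain ⟨d, a⟩ := p
    have ha : a < C.letters := hr _ (List.mem_cons_self ..)
    have hr' : C.Valid r := fun q hq => hr q (List.mem_cons_of_mem _ hq)
    simp only [timestamps, List.forall_mem_cons, add_assoc, add_right_inj]
    have hrest : C.Acc (5 + 2 * b) (x + d) (height (C.kind a) h) r ↔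
        ∀ p ∈ timestamps (T + (x + d)) r, p.2 = T + 1 → C.copy b p.1 = false := ih hr'
    rw [← hrest]
    simp only [acc_cons_iff ha, e0, e1, e2, e3, e4, e5, false_and, false_or, or_false, and_false]
    constructor
    · rintro ⟨c, -, ⟨rfl, h, h'⟩ | ⟨rfl, h, h'⟩ | ⟨rfl, h, h'⟩⟩
      · exact ⟨fun e => absurd e h.ne, h'⟩
      · exact ⟨fun e => absurd e h.ne', h'⟩
      · exact ⟨fun _ => h, h'⟩
    · rintro ⟨h, h'⟩
      rcases lt_trichotomy (x + d) 1 with H | H | H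
      · exact ⟨b, hb, Or.inl ⟨rfl, H, h'⟩⟩
      · exact ⟨b, hb, Or.inr (Or.inr ⟨rfl, h H, h'⟩)⟩
      · exact ⟨b, hb, Or.inr (Or.inl ⟨rfl, H, h'⟩)⟩

/-- No check of the automaton that starts inside the word succeeds. -/
def Good (C : Checker) : ℕ → List (ℕ × ℝ≥0) → Prop
  | _, [] => True
  | h, (a, t) :: w => (2 ≤ C.kind a → h ≠ 0) ∧
      (∀ p ∈ w.head?, p.2 ≠ t ∧ C.next a p.1 = true) ∧
      (C.kind a < 2 → ∃ p ∈ w, p.2 = t + 1 ∧ C.copy a p.1 = true) ∧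
      Good C (height (C.kind a) h) w

/-- Each way of leaving the scanning location corresponds to the negation of one conjunct of `Good`
at the current letter, and staying there to the negation of the recursive conjunct. -/
theorem acc_scan {T x : ℝ≥0} {h : ℕ} {r : List (ℝ≥0 × ℕ)} (hr : C.Valid r) :
    C.Acc 2 x h r ↔ ¬ C.Good h (timestamps T r) := by
  have e4 : ∀ c, ¬ 2 = 4 + 2 * c := by omega
  have e5 : ∀ c, ¬ 2 = 5 + 2 * c := by omega
  induction r generalizing T x h with
  | nil => simp [acc_nil, e5, timestamps, Good]
  | cons p r ih =>
    obtain ⟨d, a⟩ := p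
    have ha : a < C.letters := hr _ (List.mem_cons_self ..)
    have hr' : C.Valid r := fun q hq => hr q (List.mem_cons_of_mem _ hq)
    -- At the end of the word both sides are false: the location does not accept and the condition
    -- on a next letter is vacuous.
    have hnext : C.Acc (4 + 2 * a) 0 (height (C.kind a) h) r ↔
        ¬ ∀ p ∈ (timestamps (T + d) r).head?, p.2 ≠ T + d ∧ C.next a p.1 = true := by
      cases r with
      | nil => simp [not_acc_next_nil, timestamps]
      | cons q r =>
        obtain ⟨d', b⟩ := q
        rw [acc_next (hr' _ (List.mem_cons_self ..)) ha
          fun q hq => hr' q (List.mem_cons_of_mem _ hq)]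
        simp [timestamps]
        tauto
    have hcopy := acc_copy (T := T + d) (x := 0) (h := height (C.kind a) h) ha hr'
    have hcopy' : C.Acc (5 + 2 * a) 0 (height (C.kind a) h) r ↔
        ¬ ∃ p ∈ timestamps (T + d) r, p.2 = T + d + 1 ∧ C.copy a p.1 = true := by
      rw [hcopy, add_zero]
      push Not
      simp only [ne_eq, Bool.not_eq_true]
    have hscan : C.Acc 2 (x + d) (height (C.kind a) h) r ↔
        ¬ C.Good (height (C.kind a) h) (timestamps (T + d) r) := ih hr'
    have n0 : ¬ 2 = 0 := by decide
    have n1 : ¬ 2 = 1 := by decide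
    have n3 : ¬ 2 = 3 := by decide
    simp only [timestamps, Good, acc_cons_iff ha, e4, e5, n0, n1, n3, acc_sink hr', false_and,
      false_or, or_false, true_and, and_true]
    rw [hscan, hnext, hcopy']
    clear hscan hnext hcopy hcopy' ih
    generalize (∀ p ∈ (timestamps (T + d) r).head?, p.2 ≠ T + d ∧ C.next a p.1 = true) = P
    generalize (∃ p ∈ timestamps (T + d) r, p.2 = T + d + 1 ∧ C.copy a p.1 = true) = Q
    generalize C.Good (height (C.kind a) h) (timestamps (T + d) r) = R
    constructor
    · rintro (⟨b, -, H⟩ | H) <;> tauto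
    · intro H
      by_cases H' : 2 ≤ C.kind a ∧ h = 0
      · exact Or.inr H'
      · exact Or.inl ⟨a, ha, by tauto⟩

end Checker

/-! ### Timed words and sequences of delays -/

section Timestamps

variable {A B : Type}

theorem timestamps_map (f : A → B) (T : ℝ≥0) (r : List (ℝ≥0 × A)) :
    timestamps T (r.map fun p => (p.1, f p.2)) =
      (timestamps T r).map fun p => (f p.1, p.2) := by
  induction r generalizing T with
  | nil => rfl
  | cons p r ih => simp [timestamps, ih]

theorem le_of_mem_timestamps {T : ℝ≥0} {r : List (ℝ≥0 × A)} {p : A × ℝ≥0}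
    (hp : p ∈ timestamps T r) : T ≤ p.2 := by
  induction r generalizing T with
  | nil => simp [timestamps] at hp
  | cons q r ih =>
    simp only [timestamps, List.mem_cons] at hp
    rcases hp with rfl | hp
    · simp
    · exact le_trans (by simp) (ih hp)

theorem pairwise_timestamps (T : ℝ≥0) (r : List (ℝ≥0 × A)) :
    ((timestamps T r).map Prod.snd).Pairwise (· ≤ ·) := by
  induction r generalizing T with
  | nil => simp [timestamps]
  | cons q r ih =>
    simp only [timestamps, List.map_cons, List.pairwise_cons, ih, and_true]
    intro t ht
    obtain ⟨p, hp, rfl⟩ := List.mem_map.1 ht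
    exact le_of_mem_timestamps hp

theorem timestamps_injective (T : ℝ≥0) :
    Function.Injective (timestamps T : List (ℝ≥0 × A) → List (A × ℝ≥0)) := by
  intro r r' h
  induction r generalizing T r' with
  | nil => cases r' with
    | nil => rfl
    | cons => simp [timestamps] at h
  | cons q r ih => cases r' with
    | nil => simp [timestamps] at h
    | cons q' r' =>
      simp only [timestamps, List.cons.injEq, Prod.mk.injEq, add_right_inj] at h
      obtain ⟨⟨h1, h2⟩, h3⟩ := h
      rw [h2] at h3
      rw [ih _ h3, Prod.ext h2 h1]

theorem exists_timestamps_eq (T : ℝ≥0) (w : List (A × ℝ≥0)) (hT : ∀ p ∈ w, T ≤ p.2)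
    (hw : (w.map Prod.snd).Pairwise (· ≤ ·)) : ∃ r, timestamps T r = w := by
  induction w generalizing T with
  | nil => exact ⟨[], rfl⟩
  | cons p w ih =>
    simp only [List.map_cons, List.pairwise_cons] at hw
    obtain ⟨r, hr⟩ := ih p.2 (fun q hq => hw.1 _ (List.mem_map_of_mem hq)) hw.2
    have : T + (p.2 - T) = p.2 := add_tsub_cancel_of_le (hT p (by simp))
    exact ⟨(p.2 - T, p.1) :: r, by simp [timestamps, this, hr]⟩

theorem timestamps_ne_nil {T : ℝ≥0} {r : List (ℝ≥0 × A)} : timestamps T r ≠ [] ↔ r ≠ [] := by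
  cases r <;> simp [timestamps]

end Timestamps

/-! ### Non-universality as existence of a defect-free word -/

namespace Checker

variable {C : Checker}

theorem mem_language_iff (r : List (ℝ≥0 × Fin C.letters)) (hr : r ≠ []) :
    timestamps 0 r ∈ C.code.toAutomaton.language ↔
      C.Acc 0 0 0 (r.map fun p => (p.1, p.2.val)) ∨ C.Acc 2 0 0 (r.map fun p => (p.1, p.2.val)) ∨
      C.Acc 3 0 0 (r.map fun p => (p.1, p.2.val)) := by
  constructor
  · rintro ⟨-, s, s', r', h1, h2, h3, h4, h5, h6⟩
    obtain rfl := timestamps_injective 0 h6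
    obtain ⟨l, x, h, rfl⟩ := exists_eq_st s
    obtain rfl : x = 0 := h2 (0 : Fin 1)
    obtain rfl : h = 0 := (List.length_replicate ..).symm.trans (congrArg List.length h3)
    have := (C.acc_iff_run l 0 0 r').1 ⟨s', h4, h5⟩
    have hl : (l : ℕ) = 0 ∨ (l : ℕ) = 2 ∨ (l : ℕ) = 3 := by
      have : (l : ℕ) ∈ [0, 2, 3] := h1
      simpa using this
    rcases hl with hl | hl | hl <;> rw [hl] at this <;> tauto
  · intro H
    have key : ∀ n ∈ [0, 2, 3], C.Acc n 0 0 (r.map fun p => (p.1, p.2.val)) →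
        timestamps 0 r ∈ C.code.toAutomaton.language := by
      intro n hn h
      have hn' : n < 4 + 2 * C.letters := by
        simp only [List.mem_cons, List.not_mem_nil, or_false] at hn
        omega
      obtain ⟨s', h1, h2⟩ := (C.acc_iff_run ⟨n, hn'⟩ 0 0 r).2 h
      exact ⟨⟨timestamps_ne_nil.2 hr, pairwise_timestamps _ _⟩, st ⟨n, hn'⟩ 0 0, s', r, hn,
        fun _ => rfl, rfl, h1, h2, rfl⟩
    rcases H with H | H | H
    · exact key 0 (by simp) H
    · exact key 2 (by simp) H
    · exact key 3 (by simp) H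

/-- A word is rejected iff the searches from all three initial locations fail. The non-emptiness of
the word is implied by the condition on its first letter. -/
theorem not_isUniversal_iff : ¬ C.code.toAutomaton.IsUniversal ↔
    ∃ w : List (ℕ × ℝ≥0), (∀ p ∈ w, p.1 < C.letters) ∧ (w.map Prod.snd).Pairwise (· ≤ ·) ∧
      (∃ p ∈ w.head?, C.first p.1 = true) ∧ (∃ p ∈ w, C.halt p.1 = true) ∧ C.Good 0 w := by
  have hchar : ∀ r : List (ℝ≥0 × Fin C.letters), r ≠ [] →
      (timestamps 0 r ∉ C.code.toAutomaton.language ↔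
        (∃ p ∈ ((timestamps 0 r).map fun p => (p.1.val, p.2)).head?, C.first p.1 = true) ∧
        (∃ p ∈ (timestamps 0 r).map (fun p => (p.1.val, p.2)), C.halt p.1 = true) ∧
        C.Good 0 ((timestamps 0 r).map fun p => (p.1.val, p.2))) := by
    intro r hr
    have hv : C.Valid (r.map fun p => (p.1, p.2.val)) := by
      intro p hp
      obtain ⟨q, -, rfl⟩ := List.mem_map.1 hp
      exact q.2.2
    rw [mem_language_iff r hr, ← timestamps_map (fun a : Fin C.letters => a.val)]
    rw [acc_scan (T := 0) hv, acc_noHalt hv]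
    have hhalt : ∀ (T : ℝ≥0) (r : List (ℝ≥0 × ℕ)),
        (∃ p ∈ timestamps T r, C.halt p.1 = true) ↔ ∃ p ∈ r, C.halt p.2 = true := by
      intro T r
      induction r generalizing T with
      | nil => simp [timestamps]
      | cons q r ih => simp only [timestamps, List.exists_mem_cons_iff, ih]
    have hfirst : C.Acc 0 0 0 (r.map fun p => (p.1, p.2.val)) ↔
        ¬ ∃ p ∈ (timestamps 0 (r.map fun p => (p.1, p.2.val))).head?, C.first p.1 = true := by
      cases r with
      | nil => exact absurd rfl hr
      | cons q r =>
        rw [List.map_cons, acc_start q.2.2 fun p hp => hv p (List.mem_cons_of_mem _ hp)]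
        simp [timestamps]
    rw [hfirst, hhalt, not_or, not_or, not_not, not_not]
    refine and_congr_right fun _ => ?_
    rw [and_comm]
    refine and_congr_left fun _ => ?_
    simp
  constructor
  · intro h
    have : ∃ w ∈ timedWords (Fin C.letters), w ∉ C.code.toAutomaton.language := by
      by_contra! H
      exact h (Set.Subset.antisymm (fun w hw => hw.1) H)
    obtain ⟨w, ⟨hw, hw'⟩, hw2⟩ := this
    obtain ⟨r, rfl⟩ := exists_timestamps_eq 0 w (fun _ _ => zero_le) hw'
    have H := (hchar r (timestamps_ne_nil.1 hw)).1 hw2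
    refine ⟨(timestamps 0 r).map fun p => (p.1.val, p.2), ?_, ?_, H⟩
    · intro p hp
      obtain ⟨q, -, rfl⟩ := List.mem_map.1 hp
      exact q.1.2
    · simpa [List.map_map, Function.comp_def] using hw'
  · rintro ⟨w, h1, h2, h3, H⟩ h
    obtain ⟨v, rfl⟩ : ∃ v : List (Fin C.letters × ℝ≥0), v.map (fun p => (p.1.val, p.2)) = w :=
      ⟨w.pmap (fun p hp => (⟨p.1, hp⟩, p.2)) h1, by rw [List.map_pmap]; simp⟩
    have h2' : (v.map Prod.snd).Pairwise (· ≤ ·) := by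
      simpa [List.map_map, Function.comp_def] using h2
    obtain ⟨r, rfl⟩ := exists_timestamps_eq 0 v (fun _ _ => zero_le) h2'
    have hr : r ≠ [] := by
      rintro rfl
      simp [timestamps] at h3
    refine (hchar r hr).2 ⟨h3, H⟩ ?_
    have : C.code.toAutomaton.language = timedWords (Fin C.letters) := h
    rw [this]
    exact ⟨timestamps_ne_nil.2 hr, h2'⟩

theorem isOneClock : C.code.toAutomaton.IsOneClock := Nat.card_fin 1

theorem isOneCounter : C.code.toAutomaton.IsOneCounter := Nat.card_fin 1

theorem isVisibly : C.code.toAutomaton.IsVisibly := by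
  refine ⟨{a | C.kind a = 1}, {a | C.kind a = 0}, {a | 2 ≤ C.kind a}, ?_, ?_, ?_, ?_, ?_⟩
  · ext a
    simp only [Set.mem_union, Set.mem_ofPred_eq, Set.mem_univ, iff_true]
    omega
  · rw [Set.disjoint_left]; intro a h1 h2; simp only [Set.mem_ofPred_eq] at h1 h2; omega
  · rw [Set.disjoint_left]; intro a h1 h2; simp only [Set.mem_ofPred_eq] at h1 h2; omega
  · rw [Set.disjoint_left]; intro a h1 h2; simp only [Set.mem_ofPred_eq] at h1 h2; omega
  · rintro e ⟨r, hr, -, h2, -, h4, -⟩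
    have key : r.op ∈ ops (C.kind e.letter) := by
      rw [← h2]
      obtain ⟨a, -, ⟨b, -, q, -, o, ho, rfl⟩ | ⟨hk, rfl⟩⟩ := C.mem_edges.1 hr
      · exact ho
      · simp only
        match h : C.kind a, hk with
        | k + 2, _ => simp [ops]
    rw [h4] at key
    simp only [Set.mem_ofPred_eq]
    cases ho : e.op with
    | pop g =>
      rw [ho] at key
      match h : C.kind e.letter with
      | 0 => simp [h, ops, StackOp.map] at key
      | 1 => simp [h, ops, StackOp.map] at key
      | k + 2 => simp
    | push g =>
      rw [ho] at key
      match h : C.kind e.letter with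
      | 0 => simp
      | 1 => simp [h, ops, StackOp.map] at key
      | k + 2 => simp [h, ops, StackOp.map] at key
    | noop =>
      rw [ho] at key
      match h : C.kind e.letter with
      | 0 => simp [h, ops, StackOp.map] at key
      | 1 => simp
      | k + 2 => simp [h, ops, StackOp.map] at key
    | emptyTest =>
      rw [ho] at key
      match h : C.kind e.letter with
      | 0 => simp [h, ops, StackOp.map] at key
      | 1 => simp [h, ops, StackOp.map] at key
      | k + 2 => simp

end Checker
end TimedAutomata
-- Defect-free timed words are spirals
namespace TimedAutomata
namespace Checker

variable {C : Checker}

/-- The stack height before position `p` of the sequence `x` of letters. -/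
def heightAt (C : Checker) (x : ℕ → ℕ) : ℕ → ℕ
  | 0 => 0
  | p + 1 => height (C.kind (x p)) (C.heightAt x p)

theorem good_range'_iff (x : ℕ → ℕ) (t : ℕ → ℝ≥0) (s k : ℕ) :
    C.Good (C.heightAt x s) ((List.range' s k).map fun p => (x p, t p)) ↔
      ∀ p, s ≤ p → p < s + k → (2 ≤ C.kind (x p) → C.heightAt x p ≠ 0) ∧
        (p + 1 < s + k → t (p + 1) ≠ t p ∧ C.next (x p) (x (p + 1)) = true) ∧
        (C.kind (x p) < 2 → ∃ q, p < q ∧ q < s + k ∧ t q = t p + 1 ∧ C.copy (x p) (x q) = true) := by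
  induction k generalizing s with
  | zero =>
    simp only [List.range'_zero, List.map_nil, Good, true_iff]
    intro p h1 h2
    omega
  | succ k ih =>
    have hrest := ih (s + 1)
    rw [show s + 1 + k = s + (k + 1) by omega] at hrest
    rw [List.range'_succ, List.map_cons, Good]
    rw [show height (C.kind (x s)) (C.heightAt x s) = C.heightAt x (s + 1) from rfl, hrest]
    have hhead : (∀ p ∈ ((List.range' (s + 1) k).map fun p => (x p, t p)).head?,
        p.2 ≠ t s ∧ C.next (x s) p.1 = true) ↔
        (s + 1 < s + (k + 1) → t (s + 1) ≠ t s ∧ C.next (x s) (x (s + 1)) = true) := by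
      cases k with
      | zero => simp
      | succ k => simp [List.range'_succ]
    have hmem : (∃ p ∈ (List.range' (s + 1) k).map (fun p => (x p, t p)),
        p.2 = t s + 1 ∧ C.copy (x s) p.1 = true) ↔
        ∃ q, s < q ∧ q < s + (k + 1) ∧ t q = t s + 1 ∧ C.copy (x s) (x q) = true := by
      simp only [List.mem_map, List.mem_range'_1, exists_exists_and_eq_and]
      refine exists_congr fun q => ?_
      rw [show s + 1 + k = s + (k + 1) by omega]
      tauto
    rw [hhead, hmem]
    constructor
    · rintro ⟨h1, h2, h3, h4⟩ p hp hp'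
      rcases hp.eq_or_lt with rfl | hp
      · exact ⟨h1, h2, h3⟩
      · exact h4 p hp hp'
    · intro H
      obtain ⟨h1, h2, h3⟩ := H s le_rfl (by omega)
      exact ⟨h1, h2, h3, fun p hp hp' => H p (by omega) hp'⟩

/-- A sequence of letters `x` consisting of `n` calls, `m` internal letters and `n` returns in which
consecutive letters and letters at distance `n` are compatible. -/
structure IsSpiral (C : Checker) (n m : ℕ) (x : ℕ → ℕ) : Prop where
  pos : 0 < n
  lt : ∀ p < n + m + n, x p < C.letters
  first : C.first (x 0) = true
  halt : ∃ p < n + m + n, C.halt (x p) = true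
  kind_call : ∀ p < n, C.kind (x p) = 0
  kind_int : ∀ p, n ≤ p → p < n + m → C.kind (x p) = 1
  kind_ret : ∀ p, n + m ≤ p → p < n + m + n → 2 ≤ C.kind (x p)
  next : ∀ p, p + 1 < n + m + n → C.next (x p) (x (p + 1)) = true
  copy : ∀ p < n + m, C.copy (x p) (x (p + n)) = true

/-- The length `L` is left free because the lemma serves to bound the number of returns before the
length of the word is known. -/
theorem heightAt_spiral {n m L : ℕ} {x : ℕ → ℕ} (h1 : ∀ p < n, C.kind (x p) = 0)
    (h2 : ∀ p, n ≤ p → p < n + m → C.kind (x p) = 1)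
    (h3 : ∀ p, n + m ≤ p → p < L → 2 ≤ C.kind (x p)) :
    (∀ i ≤ n, C.heightAt x i = i) ∧ (∀ i ≤ m, C.heightAt x (n + i) = n) ∧
      ∀ i, n + m + i ≤ L → C.heightAt x (n + m + i) = n - i := by
  have a1 : ∀ i ≤ n, C.heightAt x i = i := by
    intro i hi
    induction i with
    | zero => rfl
    | succ i ih => simp [heightAt, h1 i (by omega), ih (by omega), height]
  have a2 : ∀ i ≤ m, C.heightAt x (n + i) = n := by
    intro i hi
    induction i with
    | zero => exact a1 n le_rfl
    | succ i ih => simp [heightAt, h2 (n + i) (by omega) (by omega), ih (by omega), height]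
  refine ⟨a1, a2, fun i hi => ?_⟩
  induction i with
  | zero => exact a2 m le_rfl
  | succ i ih =>
    have h := h3 (n + m + i) (by omega) (by omega)
    rw [← add_assoc, heightAt, ih (by omega)]
    match h' : C.kind (x (n + m + i)), h with
    | k + 2, _ => simp only [height]; omega

/-- The counting argument: the copy map `f` is strictly increasing and avoids the calls, while the
counter bounds the length of the word. The two bounds on `f` then coincide. -/
theorem exists_isSpiral_of_good (hnext : ∀ a b, C.next a b = true → C.kind a ≤ C.kind b)
    (hcopy : ∀ a b, C.copy a b = true → 1 ≤ C.kind b) {w : List (ℕ × ℝ≥0)}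
    (h1 : ∀ p ∈ w, p.1 < C.letters) (h2 : (w.map Prod.snd).Pairwise (· ≤ ·))
    (h3 : ∃ p ∈ w.head?, C.first p.1 = true) (h4 : ∃ p ∈ w, C.halt p.1 = true)
    (h5 : C.Good 0 w) : ∃ n m x, C.IsSpiral n m x := by
  obtain ⟨L, x, t, rfl⟩ : ∃ (L : ℕ) (x : ℕ → ℕ) (t : ℕ → ℝ≥0),
      w = (List.range' 0 L).map fun p => (x p, t p) := by
    refine ⟨w.length, fun p => (w.getD p (0, 0)).1, fun p => (w.getD p (0, 0)).2, ?_⟩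
    apply List.ext_getElem
    · simp
    · intro i hi _
      simp [hi]
  have hg := (good_range'_iff x t 0 L).1 h5
  simp only [zero_add, zero_le, true_imp_iff] at hg
  have hxL : ∀ p < L, x p < C.letters := fun p hp =>
    h1 _ (List.mem_map_of_mem (by simpa using hp))
  have hL : 0 < L := by
    rcases Nat.eq_zero_or_pos L with rfl | h
    · simp at h3
    · exact h
  have hfirst : C.first (x 0) = true := by
    obtain ⟨L, rfl⟩ : ∃ k, L = k + 1 := ⟨L - 1, by omega⟩
    simpa [List.range'_succ] using h3
  have hhalt : ∃ p < L, C.halt (x p) = true := by simpa using h4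
  have htmono : ∀ p q, p < q → q < L → t p < t q := by
    have step : ∀ p, p + 1 < L → t p < t (p + 1) := by
      intro p hp
      refine lt_of_le_of_ne ?_ ((hg p (by omega)).2.1 hp).1.symm
      have := List.pairwise_iff_getElem.1 h2 p (p + 1) (by simp; omega) (by simpa using hp)
        (by omega)
      simpa using this
    intro p q hpq
    induction q, hpq using Nat.le_induction with
    | base => exact step p
    | succ q hq ih => exact fun h => (ih (by omega)).trans (step q h)
  have hk : ∀ p q, p ≤ q → q < L → C.kind (x p) ≤ C.kind (x q) := by
    intro p q hpq
    induction q, hpq using Nat.le_induction with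
    | base => exact fun _ => le_rfl
    | succ q hq ih => exact fun h => (ih (by omega)).trans (hnext _ _ ((hg q (by omega)).2.1 h).2)
  -- Kinds do not decrease along the word, so each threshold cuts it in two; the thresholds `1` and
  -- `2` separate calls, internal letters and returns.
  have hcut : ∀ c, ∃ n ≤ L, (∀ p < n, C.kind (x p) < c) ∧ ∀ p, n ≤ p → p < L → c ≤ C.kind (x p) := by
    intro c
    classical
    have hex : ∃ n, n = L ∨ c ≤ C.kind (x n) := ⟨L, Or.inl rfl⟩
    have hle : Nat.find hex ≤ L := Nat.find_min' hex (Or.inl rfl)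
    refine ⟨Nat.find hex, hle, fun p hp => ?_, fun p hp hpL => ?_⟩
    · have := Nat.find_min hex hp
      omega
    · rcases Nat.find_spec hex with h | h
      · omega
      · exact h.trans (hk _ _ hp hpL)
  obtain ⟨n, hnL, hn1, hn2⟩ := hcut 1
  obtain ⟨n', hnL', hn1', hn2'⟩ := hcut 2
  have hnn : n ≤ n' := by
    by_contra! h
    have := hn1 n' h
    have := hn2' n' le_rfl (by omega)
    omega
  obtain ⟨m, rfl⟩ := Nat.exists_eq_add_of_le hnn
  have hcall : ∀ p < n, C.kind (x p) = 0 := fun p hp => by have := hn1 p hp; omega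
  have hint : ∀ p, n ≤ p → p < n + m → C.kind (x p) = 1 := fun p hp hp' => by
    have := hn2 p hp (by omega)
    have := hn1' p hp'
    omega
  -- A further return would be read at height `n - n = 0`.
  have hret : L ≤ n + m + n := by
    by_contra! h
    have h0 := (heightAt_spiral hcall hint hn2').2.2 n (by omega)
    exact (hg (n + m + n) h).1 (hn2' _ (by omega) h) (by omega)
  have hcp : ∀ p, ∃ q, p < n + m → p < q ∧ q < L ∧ t q = t p + 1 ∧ C.copy (x p) (x q) = true := by
    intro p
    by_cases hp : p < n + m
    · obtain ⟨q, h⟩ := (hg p (by omega)).2.2 (hn1' p hp)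
      exact ⟨q, fun _ => h⟩
    · exact ⟨0, fun h => absurd h hp⟩
  choose f hf using hcp
  -- Timestamps are strictly increasing, and copies are shifted by the same unit of time.
  have hfmono : ∀ p, p + 1 < n + m → f p < f (p + 1) := by
    intro p hp
    by_contra! h
    have e1 := (hf p (by omega)).2.2.1
    have e2 := (hf (p + 1) hp).2.2.1
    have e3 : t (f (p + 1)) ≤ t (f p) := by
      rcases h.eq_or_lt with h | h
      · rw [h]
      · exact (htmono _ _ h (hf p (by omega)).2.1).le
    rw [e1, e2] at e3
    exact absurd (htmono p (p + 1) (by omega) (by omega)) (not_lt.2 (le_of_add_le_add_right e3))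
  -- The first copy is not a call, so it lies at `n` or later; each further copy advances by at
  -- least one.
  have hlow : ∀ p < n + m, p + n ≤ f p := by
    intro p hp
    induction p with
    | zero =>
      by_contra! h
      have := hcopy _ _ (hf 0 hp).2.2.2
      have := hcall (f 0) (by omega)
      omega
    | succ p ih => have := ih (by omega); have := hfmono p hp; omega
  -- Counted from the end: `i` more copies must fit between `f p` and the end of the word.
  have hup : ∀ i p, p + 1 + i = n + m → f p + i < L := by
    intro i
    induction i with
    | zero => exact fun p hp => (hf p (by omega)).2.1
    | succ i ih => intro p hp; have := ih (p + 1) (by omega); have := hfmono p (by omega); omega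
  have hnm : 0 < n + m := by omega
  have hLeq : L = n + m + n := by
    have := hup 0 (n + m - 1) (by omega)
    have := hlow (n + m - 1) (by omega)
    omega
  have hfeq : ∀ p < n + m, f p = p + n := by
    intro p hp
    have := hlow p hp
    have := hup (n + m - 1 - p) p (by omega)
    omega
  subst hLeq
  refine ⟨n, m, x, ?_, hxL, hfirst, hhalt, hcall, hint, hn2', fun p hp => ((hg p (by omega)).2.1 hp).2,
    fun p hp => ?_⟩
  · have := (hf 0 hnm).1
    rw [hfeq 0 hnm] at this
    omega
  · rw [← hfeq p hp]
    exact (hf p hp).2.2.2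

/-- With the letter `p` at time `p / n`, times are distinct and the letter `p + n` comes exactly one
unit after `p`. -/
theorem IsSpiral.exists_good {n m : ℕ} {x : ℕ → ℕ} (hx : C.IsSpiral n m x) :
    ∃ w : List (ℕ × ℝ≥0), (∀ p ∈ w, p.1 < C.letters) ∧ (w.map Prod.snd).Pairwise (· ≤ ·) ∧
      (∃ p ∈ w.head?, C.first p.1 = true) ∧ (∃ p ∈ w, C.halt p.1 = true) ∧ C.Good 0 w := by
  have hn : (n : ℝ≥0) ≠ 0 := Nat.cast_ne_zero.2 hx.pos.ne'
  have hpos := hx.pos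
  refine ⟨(List.range' 0 (n + m + n)).map fun p => (x p, (p : ℝ≥0) / n), ?_, ?_, ?_, ?_, ?_⟩
  · intro p hp
    obtain ⟨i, hi, rfl⟩ := List.mem_map.1 hp
    exact hx.lt i (by simpa using hi)
  · rw [List.map_map, List.pairwise_map]
    refine List.Pairwise.imp ?_ (List.pairwise_lt_range' (s := 0) (n := n + m + n))
    intro a b hab
    simp only [Function.comp_apply]
    gcongr
  · obtain ⟨k, hk⟩ : ∃ k, n + m + n = k + 1 := ⟨n + m + n - 1, by omega⟩
    rw [hk, List.range'_succ]
    simpa using hx.first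
  · obtain ⟨p, hp, h⟩ := hx.halt
    exact ⟨_, List.mem_map_of_mem (a := p) (by simpa using hp), h⟩
  · refine (good_range'_iff x (fun p => (p : ℝ≥0) / n) 0 (n + m + n)).2 fun p _ hp => ?_
    rw [zero_add] at hp ⊢
    have hh := heightAt_spiral hx.kind_call hx.kind_int hx.kind_ret
    have hkind : C.kind (x p) < 2 → p < n + m := by
      intro h
      by_contra! h'
      have := hx.kind_ret p h' hp
      omega
    refine ⟨fun h => ?_, fun h => ⟨?_, hx.next p h⟩, fun h => ⟨p + n, ?_, ?_, ?_, hx.copy p (hkind h)⟩⟩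
    · have hle : n + m ≤ p := by
        by_contra! h'
        rcases lt_or_ge p n with h2 | h2
        · rw [hx.kind_call p h2] at h; omega
        · rw [hx.kind_int p h2 h'] at h; omega
      obtain ⟨i, rfl⟩ := Nat.exists_eq_add_of_le hle
      rw [hh.2.2 i (by omega)]
      omega
    · intro h
      rw [div_left_inj' hn] at h
      have := Nat.cast_injective h
      omega
    · omega
    · have := hkind h; omega
    · push_cast
      rw [add_div, div_self hn]

theorem not_isUniversal_iff_exists_isSpiral
    (hnext : ∀ a b, C.next a b = true → C.kind a ≤ C.kind b)
    (hcopy : ∀ a b, C.copy a b = true → 1 ≤ C.kind b) :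
    ¬ C.code.toAutomaton.IsUniversal ↔ ∃ n m x, C.IsSpiral n m x := by
  rw [not_isUniversal_iff]
  constructor
  · rintro ⟨w, h1, h2, h3, h4, h5⟩
    exact exists_isSpiral_of_good hnext hcopy h1 h2 h3 h4 h5
  · rintro ⟨n, m, x, hx⟩
    exact hx.exists_good

end Checker
end TimedAutomata
-- Turing machine computations as spirals of cells
namespace TimedAutomata

open Turing

section Rows

variable {Γ Λ : Type}

/-- A configuration of a Turing machine with a tape indexed by the integers. -/
structure ZCfg (Γ Λ : Type) where
  state : Λ
  pos : ℤ
  tape : ℤ → Γ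

namespace ZCfg

/-- One step of the machine; a halted configuration does not change. -/
def step (M : Λ → Γ → Option (Λ × TM0.Stmt Γ)) (c : ZCfg Γ Λ) : ZCfg Γ Λ :=
  match M c.state (c.tape c.pos) with
  | none => c
  | some (q, .write s) => ⟨q, c.pos, Function.update c.tape c.pos s⟩
  | some (q, .move .left) => ⟨q, c.pos - 1, c.tape⟩
  | some (q, .move .right) => ⟨q, c.pos + 1, c.tape⟩

def Halted (M : Λ → Γ → Option (Λ × TM0.Stmt Γ)) (c : ZCfg Γ Λ) : Prop :=
  M c.state (c.tape c.pos) = none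

end ZCfg

/-- The content of a cell: `none` is the wall; otherwise a symbol and, at the head, the state. -/
abbrev Cell (Γ Λ : Type) : Type := Option (Γ × Option Λ)

def ZCfg.cell (c : ZCfg Γ Λ) (z : ℤ) : Cell Γ Λ :=
  some (c.tape z, if z = c.pos then some c.state else none)

/-- The local rule that describes the content of a cell after a step in terms of the contents of the
cell and its two neighbours. It is undefined when the head hits the wall. -/
def rule (M : Λ → Γ → Option (Λ × TM0.Stmt Γ)) (l b r : Cell Γ Λ) : Option (Cell Γ Λ) :=
  match b with
  | none => some none
  | some (s, some q) =>
    match M q s with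
    | none => some b
    | some (q', .write s') => some (some (s', some q'))
    | some (_, .move .left) => if l.isNone then none else some (some (s, none))
    | some (_, .move .right) => if r.isNone then none else some (some (s, none))
  | some (s, none) =>
    match l.bind (fun p => p.2.bind fun q => M q p.1) with
    | some (q', .move .right) => some (some (s, some q'))
    | _ =>
      match r.bind (fun p => p.2.bind fun q => M q p.1) with
      | some (q', .move .left) => some (some (s, some q'))
      | _ => some b

variable {M : Λ → Γ → Option (Λ × TM0.Stmt Γ)} {c : ZCfg Γ Λ} {z : ℤ} {l r : Cell Γ Λ}

theorem bind_cell (c : ZCfg Γ Λ) (z : ℤ) :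
    ((c.cell z).bind fun p => p.2.bind fun q => M q p.1) =
      if z = c.pos then M c.state (c.tape c.pos) else none := by
  by_cases h : z = c.pos <;> simp [ZCfg.cell, h]

/-- A wall in place of a neighbour is indistinguishable from a cell without the head, which is
correct if the head is elsewhere. -/
theorem bind_eq_of_or {z' : ℤ} (hl : l = c.cell z' ∨ (l = none ∧ c.pos ≠ z')) :
    (l.bind fun p => p.2.bind fun q => M q p.1) =
      if z' = c.pos then M c.state (c.tape c.pos) else none := by
  rcases hl with rfl | ⟨rfl, h⟩
  · exact bind_cell c z'
  · simp [h.symm]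

theorem rule_cell_of_ne (hl : l = c.cell (z - 1) ∨ (l = none ∧ c.pos ≠ z - 1))
    (hr : r = c.cell (z + 1) ∨ (r = none ∧ c.pos ≠ z + 1)) (hz : z ≠ c.pos) :
    rule M l (c.cell z) r = some ((c.step M).cell z) := by
  have hb : c.cell z = some (c.tape z, none) := by simp [ZCfg.cell, hz]
  rw [hb, rule, bind_eq_of_or hl, bind_eq_of_or hr]
  by_cases h1 : z - 1 = c.pos
  · have h2 : z + 1 ≠ c.pos := by omega
    rw [if_pos h1, if_neg h2]
    rcases hM : M c.state (c.tape c.pos) with _ | ⟨q', (_ | _) | s⟩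
    · simp [ZCfg.step, hM, ZCfg.cell, hz]
    · simp [ZCfg.step, hM, ZCfg.cell, show z ≠ c.pos - 1 by omega]
    · simp [ZCfg.step, hM, ZCfg.cell, show z = c.pos + 1 by omega]
    · simp [ZCfg.step, hM, ZCfg.cell, hz]
  · rw [if_neg h1]
    by_cases h2 : z + 1 = c.pos
    · rw [if_pos h2]
      rcases hM : M c.state (c.tape c.pos) with _ | ⟨q', (_ | _) | s⟩
      · simp [ZCfg.step, hM, ZCfg.cell, hz]
      · simp [ZCfg.step, hM, ZCfg.cell, show z = c.pos - 1 by omega]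
      · simp [ZCfg.step, hM, ZCfg.cell, show z ≠ c.pos + 1 by omega]
      · simp [ZCfg.step, hM, ZCfg.cell, hz]
    · rw [if_neg h2]
      rcases hM : M c.state (c.tape c.pos) with _ | ⟨q', (_ | _) | s⟩
      · simp [ZCfg.step, hM, ZCfg.cell, hz]
      · simp [ZCfg.step, hM, ZCfg.cell, show z ≠ c.pos - 1 by omega]
      · simp [ZCfg.step, hM, ZCfg.cell, show z ≠ c.pos + 1 by omega]
      · simp [ZCfg.step, hM, ZCfg.cell, hz]

theorem rule_cell_pos (hl : l.isNone = false) (hr : r.isNone = false) :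
    rule M l (c.cell c.pos) r = some ((c.step M).cell c.pos) := by
  have hb : c.cell c.pos = some (c.tape c.pos, some c.state) := by simp [ZCfg.cell]
  rw [hb, rule]
  rcases hM : M c.state (c.tape c.pos) with _ | ⟨q', (_ | _) | s⟩
  · simp [ZCfg.step, hM, ZCfg.cell]
  · simp [ZCfg.step, hM, ZCfg.cell, hl, show c.pos ≠ c.pos - 1 by omega]
  · simp [ZCfg.step, hM, ZCfg.cell, hr]
  · simp [ZCfg.step, hM, ZCfg.cell]

/-- Since the rule is undefined when the head hits a wall, its mere definedness shows that the row
is wide enough for the step. -/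
theorem rule_cell_pos_eq_some {b : Cell Γ Λ} (h : rule M l (c.cell c.pos) r = some b) :
    b = (c.step M).cell c.pos ∧ ((c.step M).pos = c.pos ∨
      ((c.step M).pos = c.pos - 1 ∧ l ≠ none) ∨ ((c.step M).pos = c.pos + 1 ∧ r ≠ none)) := by
  have hb : c.cell c.pos = some (c.tape c.pos, some c.state) := by simp [ZCfg.cell]
  rw [hb, rule] at h
  rcases hM : M c.state (c.tape c.pos) with _ | ⟨q', (_ | _) | s⟩
  · simp [hM] at h
    simp [ZCfg.step, hM, ZCfg.cell, ← h]
  · simp [hM] at h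
    simp [ZCfg.step, hM, ZCfg.cell, ← h.2, h.1, show c.pos ≠ c.pos - 1 by omega]
  · simp [hM] at h
    simp [ZCfg.step, hM, ZCfg.cell, ← h.2, h.1]
  · simp [hM] at h
    simp [ZCfg.step, hM, ZCfg.cell, ← h]

/-- The initial configuration with input `L`. -/
def ZCfg.init [Inhabited Γ] [Inhabited Λ] (L : List Γ) : ZCfg Γ Λ :=
  ⟨default, 0, fun z => if z < 0 then default else L.getI z.toNat⟩

/-- The configuration as a row of cells that begins with a wall and continues with the part of the
tape whose position `0` has number `i₀` in the row. -/
def ZCfg.row (c : ZCfg Γ Λ) (i₀ i : ℕ) : Cell Γ Λ :=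
  if i = 0 then none else c.cell (i - i₀)

/-- The word describing the initial configuration: the wall, one blank, the input and blanks. -/
def initWord [Inhabited Γ] [Inhabited Λ] (L : List Γ) : List (Cell Γ Λ) :=
  (List.range (L.length + 4)).map ((ZCfg.init L).row 2)

def HaltedCell (M : Λ → Γ → Option (Λ × TM0.Stmt Γ)) (b : Cell Γ Λ) : Prop :=
  ∃ s q, b = some (s, some q) ∧ M q s = none

/-- A sequence `y` of `m` cells made of rows of length `n`, the first of which spells the word `w` with
arbitrary repetitions of the cells number `1` and `w.length - 1`. -/
structure IsCellSpiral (M : Λ → Γ → Option (Λ × TM0.Stmt Γ)) (w : List (Cell Γ Λ)) (n m : ℕ)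
    (j : ℕ → ℕ) (y : ℕ → Cell Γ Λ) : Prop where
  pos : 0 < n
  zero : j 0 = 0
  step : ∀ p, p + 1 < n → j (p + 1) = j p + 1 ∨
    (j (p + 1) = j p ∧ (j p = 1 ∨ j p + 1 = w.length))
  last : j (n - 1) + 1 = w.length
  init : ∀ p < n, p < m → w[j p]? = some (y p)
  copy : ∀ p, p + n < m → rule M (y (p - 1)) (y p) (y (p + 1)) = some (y (p + n))
  halt : ∃ p < m, HaltedCell M (y p)

/-- Besides equal tape positions, any two positions left of the origin agree, as do any two beyond
the input and right of the head: all of them are blank. -/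
theorem row_init_eq [Inhabited Γ] [Inhabited Λ] (L : List Γ) {i i' i₀ i₀' : ℕ} (hi : i ≠ 0)
    (hi' : i' ≠ 0) (h : (i : ℤ) - i₀ = i' - i₀' ∨ (i < i₀ ∧ i' < i₀') ∨
      (i₀ + L.length < i + 1 ∧ i₀ < i ∧ i₀' + L.length < i' + 1 ∧ i₀' < i')) :
    (ZCfg.init L : ZCfg Γ Λ).row i₀ i = (ZCfg.init L : ZCfg Γ Λ).row i₀' i' := by
  rw [ZCfg.row, ZCfg.row, if_neg hi, if_neg hi']
  rcases h with h | ⟨h1, h2⟩ | ⟨h1, h2, h3, h4⟩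
  · rw [h]
  · have a1 : (i : ℤ) - i₀ < 0 := by omega
    have a2 : (i' : ℤ) - i₀' < 0 := by omega
    simp [ZCfg.cell, ZCfg.init, a1, a2, a1.ne, a2.ne]
  · have a1 : ¬ (i : ℤ) - i₀ < 0 := by omega
    have a2 : ¬ (i' : ℤ) - i₀' < 0 := by omega
    have b1 : L.getI ((i : ℤ) - i₀).toNat = default := List.getI_eq_default L (by omega)
    have b2 : L.getI ((i' : ℤ) - i₀').toNat = default := List.getI_eq_default L (by omega)
    simp only [ZCfg.cell, ZCfg.init, a1, a2, b1, b2, if_false,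
      show (i : ℤ) - i₀ ≠ 0 by omega, show (i' : ℤ) - i₀' ≠ 0 by omega]

theorem getElem?_initWord [Inhabited Γ] [Inhabited Λ] (L : List Γ) {i : ℕ}
    (hi : i < L.length + 4) :
    (initWord L : List (Cell Γ Λ))[i]? = some ((ZCfg.init L).row 2 i) := by
  simp [initWord, hi]

theorem length_initWord [Inhabited Γ] [Inhabited Λ] (L : List Γ) :
    (initWord L : List (Cell Γ Λ)).length = L.length + 4 := by
  simp [initWord]

/-- The index `j` starts at `0`, may stay at `1`, then rises by single steps to the last index,
where it may stay. So the first row is an initial configuration with some padding, and `i₀` is the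
first place where `j` reaches `2`, the index of the origin in `initWord`. -/
theorem IsCellSpiral.exists_row [Inhabited Γ] [Inhabited Λ] {L : List Γ} {n m : ℕ} {j : ℕ → ℕ}
    {y : ℕ → Cell Γ Λ} (h : IsCellSpiral M (initWord L) n m j y) :
    ∃ i₀, 1 ≤ i₀ ∧ i₀ < n ∧ ∀ p < n, p < m → y p = (ZCfg.init L).row i₀ p := by
  classical
  have hpos := h.pos
  have hlast := h.last
  have hstep := h.step
  have hzero := h.zero
  rw [length_initWord] at hlast
  simp only [length_initWord] at hstep
  have hex : ∃ p, 2 ≤ j p := ⟨n - 1, by omega⟩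
  obtain ⟨i₀, hi₀, hmin⟩ : ∃ i₀, 2 ≤ j i₀ ∧ ∀ p < i₀, j p < 2 :=
    ⟨Nat.find hex, Nat.find_spec hex, fun p hp => by have := Nat.find_min hex hp; omega⟩
  have hi₀n : i₀ ≤ n - 1 := by
    by_contra! H
    have := hmin _ H
    omega
  have h1 : ∀ p, 1 ≤ p → p < i₀ → j p = 1 := by
    intro p hp
    induction p, hp using Nat.le_induction with
    | base =>
      intro h1
      have := hstep 0 (by omega)
      rw [zero_add] at this
      have := hmin 1 h1
      omega
    | succ p hp ih =>
      intro h1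
      have := hstep p (by omega)
      have := hmin (p + 1) h1
      have := ih (by omega)
      omega
  have hi₀1 : i₀ ≠ 0 := by
    rintro rfl
    omega
  have hi₀2 : i₀ ≠ 1 := by
    rintro rfl
    have := hstep 0 (by omega)
    rw [zero_add] at this
    omega
  have h2 : ∀ i, i₀ + i < n → j (i₀ + i) = min (i + 2) (L.length + 3) := by
    intro i
    induction i with
    | zero =>
      intro _
      have e := h1 (i₀ - 1) (by omega) (by omega)
      have := hstep (i₀ - 1) (by omega)
      rw [show i₀ - 1 + 1 = i₀ by omega] at this
      rw [add_zero]
      omega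
    | succ i ih =>
      intro hi
      have := ih (by omega)
      have := hstep (i₀ + i) (by omega)
      rw [← add_assoc]
      -- The step condition alone would let `j` run past the word; as it never decreases, its
      -- prescribed last value forbids this.
      have hb : j (i₀ + i + 1) < L.length + 4 := by
        by_contra! H
        have hge : ∀ q, i₀ + i + 1 ≤ q → q ≤ n - 1 → L.length + 4 ≤ j q := by
          intro q hq
          induction q, hq using Nat.le_induction with
          | base => exact fun _ => H
          | succ q hq ih =>
            intro hq'
            have := ih (by omega)
            have := hstep q (by omega)
            omega
        have := hge (n - 1) (by omega) le_rfl
        omega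
      omega
  refine ⟨i₀, by omega, by omega, fun p hp hpm => ?_⟩
  have hi := h.init p hp hpm
  rcases Nat.eq_zero_or_pos p with rfl | hp0
  · rw [hzero, getElem?_initWord L (by omega)] at hi
    rw [← Option.some_injective _ hi]
    rfl
  rcases lt_or_ge p i₀ with hlt | hge
  · rw [h1 p hp0 hlt, getElem?_initWord L (by omega)] at hi
    rw [← Option.some_injective _ hi]
    exact row_init_eq L (by omega) (by omega) (by omega)
  · obtain ⟨i, rfl⟩ := Nat.exists_eq_add_of_le hge
    rw [h2 i hp, getElem?_initWord L (by omega)] at hi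
    rw [← Option.some_injective _ hi]
    refine row_init_eq L (by omega) (by omega) ?_
    rcases le_total (i + 2) (L.length + 3) with h3 | h3
    · rw [min_eq_left h3]
      left
      push_cast
      ring
    · rw [min_eq_right h3]
      right; right
      omega

/-- By induction, row `a` is the configuration after `a` steps. The right neighbour of the last cell
of a row is the wall that begins the next row, so walls bound every row on both sides. -/
theorem IsCellSpiral.exists_halted [Inhabited Γ] [Inhabited Λ] {L : List Γ} {n m : ℕ} {j : ℕ → ℕ}
    {y : ℕ → Cell Γ Λ} (h : IsCellSpiral M (initWord L) n m j y) :
    ∃ k, ((ZCfg.step M)^[k] (ZCfg.init L)).Halted M := by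
  obtain ⟨i₀, hi₀, hi₀n, hrow⟩ := h.exists_row
  set Z : ℕ → ZCfg Γ Λ := fun k => (ZCfg.step M)^[k] (ZCfg.init L) with hZ
  have hZs : ∀ k, Z (k + 1) = (Z k).step M := fun k => Function.iterate_succ_apply' ..
  have hwall : ∀ a, a * n < m → y (a * n) = none := by
    intro a
    induction a with
    | zero =>
      intro hm
      rw [zero_mul] at hm ⊢
      rw [hrow 0 (by omega) hm]
      rfl
    | succ a ih =>
      intro hm
      have hs : (a + 1) * n = a * n + n := by ring
      rw [hs] at hm ⊢
      have := h.copy (a * n) hm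
      rw [ih (by omega), rule] at this
      exact (Option.some_injective _ this).symm
  -- The last row may be incomplete, and then the cell under the head need not be present; the head
  -- is located only in complete rows.
  have key : ∀ a, (∀ i < n, a * n + i < m → y (a * n + i) = (Z a).row i₀ i) ∧
      ((a + 1) * n ≤ m → 1 ≤ i₀ + (Z a).pos ∧ i₀ + (Z a).pos < n) := by
    intro a
    induction a with
    | zero =>
      refine ⟨fun i hi him => ?_, fun _ => ?_⟩
      · rw [zero_mul, zero_add] at him ⊢
        exact hrow i hi him
      · simp only [hZ, Function.iterate_zero, id_eq, ZCfg.init, add_zero]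
        omega
    | succ a ih =>
      obtain ⟨ih1, ih2⟩ := ih
      have hs : (a + 1) * n = a * n + n := by ring
      rw [hs] at ih2
      -- the neighbours of the cell `i` in row `a`
      have hcell : ∀ i, 1 ≤ i → i < n → a * n + n + i < m →
          ∃ l r, rule M l ((Z a).cell (i - i₀)) r = some (y (a * n + n + i)) ∧
          (i = 1 → l = none) ∧ (i + 1 = n → r = none) ∧
          (l = (Z a).cell (i - i₀ - 1) ∨ (l = none ∧ (Z a).pos ≠ i - i₀ - 1)) ∧
          (r = (Z a).cell (i - i₀ + 1) ∨ (r = none ∧ (Z a).pos ≠ i - i₀ + 1)) := by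
        intro i hi1 hin him
        obtain ⟨hp1, hp2⟩ := ih2 (by omega)
        have hc := h.copy (a * n + i) (by omega)
        rw [show a * n + i + n = a * n + n + i by omega, ih1 i hin (by omega),
          ZCfg.row, if_neg (by omega)] at hc
        have el : y (a * n + i - 1) = (Z a).row i₀ (i - 1) := by
          rw [← ih1 (i - 1) (by omega) (by omega)]
          congr 1
          omega
        refine ⟨_, _, hc, ?_, ?_, ?_, ?_⟩
        · rintro rfl
          rw [el]; rfl
        · intro e
          have := hwall (a + 1) (by omega)
          rw [hs] at this
          rw [show a * n + i + 1 = a * n + n by omega, this]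
        · rw [el, ZCfg.row]
          rcases Nat.eq_or_lt_of_le hi1 with rfl | hi2
          · exact Or.inr ⟨rfl, by push_cast; omega⟩
          · left
            rw [if_neg (by omega)]
            congr 1
            omega
        · rcases Nat.eq_or_lt_of_le hin with e | e
          · right
            have := hwall (a + 1) (by omega)
            rw [hs] at this
            exact ⟨by rw [show a * n + i + 1 = a * n + n by omega, this], by omega⟩
          · left
            rw [show a * n + i + 1 = a * n + (i + 1) by omega, ih1 (i + 1) e (by omega), ZCfg.row,
              if_neg (by omega)]
            congr 1
            push_cast
            ring
      constructor
      · intro i hin him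
        rw [hs] at him ⊢
        rcases Nat.eq_zero_or_pos i with rfl | hi
        · have := hwall (a + 1) (by omega)
          rw [hs] at this
          rw [add_zero, this]
          rfl
        obtain ⟨l, r, hr1, -, -, hl, hr⟩ := hcell i hi hin him
        rw [ZCfg.row, if_neg (by omega), hZs]
        by_cases hz : (i : ℤ) - i₀ = (Z a).pos
        · rw [hz] at hr1 ⊢
          exact (rule_cell_pos_eq_some hr1).1
        · rw [rule_cell_of_ne hl hr hz] at hr1
          exact (Option.some_injective _ hr1).symm
      · intro hm
        rw [show (a + 1 + 1) * n = a * n + n + n by ring] at hm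
        obtain ⟨hp1, hp2⟩ := ih2 (by omega)
        obtain ⟨i, hi⟩ : ∃ i : ℕ, (i : ℤ) = i₀ + (Z a).pos := ⟨(i₀ + (Z a).pos).toNat, by omega⟩
        obtain ⟨l, r, hr1, hl0, hr0, -, -⟩ := hcell i (by omega) (by omega) (by omega)
        rw [show (i : ℤ) - i₀ = (Z a).pos by omega] at hr1
        rw [hZs]
        rcases (rule_cell_pos_eq_some hr1).2 with e | ⟨e, e'⟩ | ⟨e, e'⟩
        · omega
        · have : i ≠ 1 := fun h => e' (hl0 h)
          omega
        · have : i + 1 ≠ n := fun h => e' (hr0 h)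
          omega
  obtain ⟨p, hp, s, q, hy, hM⟩ := h.halt
  refine ⟨p / n, ?_⟩
  have hdm : p / n * n + p % n = p := by rw [mul_comm]; exact Nat.div_add_mod p n
  have := (key (p / n)).1 (p % n) (Nat.mod_lt _ h.pos) (by rwa [hdm])
  rw [hdm, hy, ZCfg.row] at this
  split_ifs at this with h0
  rw [ZCfg.cell] at this
  simp only [Option.some.injEq, Prod.mk.injEq] at this
  obtain ⟨h1, h2⟩ := this
  split_ifs at h2 with h3
  rw [Option.some.injEq] at h2
  change ZCfg.Halted M (Z (p / n))
  rw [ZCfg.Halted, ← h3, ← h1, ← h2]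
  exact hM

theorem ZCfg.abs_pos_iterate_le (M : Λ → Γ → Option (Λ × TM0.Stmt Γ)) (c : ZCfg Γ Λ)
    (hc : c.pos = 0) (k : ℕ) : |((ZCfg.step M)^[k] c).pos| ≤ k := by
  induction k with
  | zero => simp [hc]
  | succ k ih =>
    rw [Function.iterate_succ_apply', ZCfg.step]
    rw [abs_le] at ih ⊢
    push_cast
    split <;> (try simp only) <;> omega

/-- In `k` steps the head moves at most `k` cells from the origin, so rows with the origin in column
`k + 2` and enough room on the right hold the whole computation; rows `0` to `k` are written out. -/
theorem exists_isCellSpiral [Inhabited Γ] [Inhabited Λ] {L : List Γ} {k : ℕ}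
    (hk : ((ZCfg.step M)^[k] (ZCfg.init L)).Halted M) :
    ∃ n m j y, IsCellSpiral M (initWord L : List (Cell Γ Λ)) n m j y := by
  set Z : ℕ → ZCfg Γ Λ := fun k => (ZCfg.step M)^[k] (ZCfg.init L) with hZ
  have hZs : ∀ k, Z (k + 1) = (Z k).step M := fun k => Function.iterate_succ_apply' ..
  have hZp : ∀ a, |(Z a).pos| ≤ a := ZCfg.abs_pos_iterate_le M _ rfl
  obtain ⟨n, hn⟩ : ∃ n, n = k + 2 + L.length + k + 4 := ⟨_, rfl⟩
  have hn0 : 0 < n := by omega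
  have hy : ∀ a i, i < n → (Z ((a * n + i) / n)).row (k + 2) ((a * n + i) % n) =
      (Z a).row (k + 2) i := by
    intro a i hi
    rw [mul_comm, Nat.mul_add_div hn0, Nat.mul_add_mod, Nat.div_eq_of_lt hi, Nat.mod_eq_of_lt hi,
      add_zero]
  refine ⟨n, (k + 1) * n, fun p => if p = 0 then 0 else if p < k + 2 then 1 else
    min (p - (k + 2) + 2) (L.length + 3), fun p => (Z (p / n)).row (k + 2) (p % n),
    hn0, rfl, ?_, ?_, ?_, ?_, ?_⟩
  · intro p hp
    rw [length_initWord]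
    grind
  · rw [length_initWord]
    grind
  · intro p hp _
    rw [Nat.div_eq_of_lt hp, Nat.mod_eq_of_lt hp]
    split_ifs with h0 h1
    · rw [getElem?_initWord L (by omega), h0]
      rfl
    · rw [getElem?_initWord L (by omega)]
      congr 1
      exact row_init_eq L (by omega) (by omega) (by omega)
    · rw [getElem?_initWord L (by omega)]
      congr 1
      exact row_init_eq L (by omega) (by omega) (by omega)
  · intro p hp
    obtain ⟨a, i, hi, rfl⟩ : ∃ a i, i < n ∧ p = a * n + i :=
      ⟨p / n, p % n, Nat.mod_lt _ hn0, by rw [mul_comm]; exact (Nat.div_add_mod p n).symm⟩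
    have hak : a < k := by
      have h1 : (a + 1) * n < (k + 1) * n := by
        have : (a + 1) * n = a * n + n := by ring
        omega
      have := Nat.lt_of_mul_lt_mul_right h1
      omega
    have hpa := abs_le.1 (hZp a)
    rw [show a * n + i + n = (a + 1) * n + i by ring, hy a i hi, hy (a + 1) i hi]
    -- In column `0` the rule keeps the wall whatever its neighbours are, so the meaningless left
    -- neighbour at position `0` does no harm.
    rcases Nat.eq_zero_or_pos i with rfl | hi0
    · rfl
    have el : (Z ((a * n + i - 1) / n)).row (k + 2) ((a * n + i - 1) % n) =
        (Z a).row (k + 2) (i - 1) := by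
      rw [← hy a (i - 1) (by omega), show a * n + i - 1 = a * n + (i - 1) by omega]
    rw [el, hZs]
    have hrow : ∀ c : ZCfg Γ Λ, c.row (k + 2) i = c.cell ((i : ℤ) - (k + 2 : ℕ)) :=
      fun c => if_neg hi0.ne'
    rw [hrow, hrow]
    have er : (i + 1 < n ∧ (Z ((a * n + i + 1) / n)).row (k + 2) ((a * n + i + 1) % n) =
        (Z a).cell ((i : ℤ) - (k + 2 : ℕ) + 1)) ∨ (i + 1 = n ∧
          (Z ((a * n + i + 1) / n)).row (k + 2) ((a * n + i + 1) % n) = none) := by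
      rcases Nat.eq_or_lt_of_le hi with e | e
      · right
        refine ⟨e, ?_⟩
        rw [show a * n + i + 1 = (a + 1) * n + 0 by rw [add_mul]; omega, hy _ _ hn0]
        rfl
      · left
        refine ⟨e, ?_⟩
        rw [add_assoc, hy _ _ e, ZCfg.row, if_neg (by omega)]
        congr 1
        push_cast
        ring
    have el' : (2 ≤ i ∧ (Z a).row (k + 2) (i - 1) =
        (Z a).cell ((i : ℤ) - (k + 2 : ℕ) - 1)) ∨ (i = 1 ∧
          (Z a).row (k + 2) (i - 1) = none) := by
      rcases Nat.eq_or_lt_of_le hi0 with e | e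
      · exact Or.inr ⟨e.symm, if_pos (by omega)⟩
      · refine Or.inl ⟨e, ?_⟩
        rw [ZCfg.row, if_neg (by omega)]
        congr 1
        omega
    by_cases hz : (i : ℤ) - (k + 2 : ℕ) = (Z a).pos
    · rcases er with ⟨-, er⟩ | ⟨er, -⟩
      swap
      · omega
      rcases el' with ⟨-, el'⟩ | ⟨el', -⟩
      swap
      · omega
      rw [er, el', hz]
      exact rule_cell_pos rfl rfl
    · refine rule_cell_of_ne ?_ ?_ hz
      · rcases el' with ⟨-, el'⟩ | ⟨e, el'⟩
        · exact Or.inl el'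
        · exact Or.inr ⟨el', by push_cast; omega⟩
      · rcases er with ⟨-, er⟩ | ⟨e, er⟩
        · exact Or.inl er
        · exact Or.inr ⟨er, by push_cast; omega⟩
  · have hpk := abs_le.1 (hZp k)
    obtain ⟨i, hi⟩ : ∃ i : ℕ, (i : ℤ) = (k + 2 : ℕ) + (Z k).pos :=
      ⟨((k + 2 : ℕ) + (Z k).pos).toNat, by omega⟩
    refine ⟨k * n + i, ?_, (Z k).tape (Z k).pos, (Z k).state, ?_, hk⟩
    · rw [add_mul]
      omega
    · rw [hy k i (by omega), ZCfg.row, if_neg (by omega)]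
      rw [show (i : ℤ) - (k + 2 : ℕ) = (Z k).pos by omega]
      simp [ZCfg.cell]

end Rows

end TimedAutomata
-- A finite machine with undecidable halting problem
namespace TimedAutomata

open Turing

section Restrict

variable {Γ Λ : Type} [Inhabited Λ]

/-- The restriction of a Turing machine to a finite set of states. -/
noncomputable def restrict (M : TM0.Machine Γ Λ) (S : Finset Λ) :
    S → Γ → Option (S × TM0.Stmt Γ) := by
  classical
  exact fun q a => (M q a).bind fun p => if h : p.1 ∈ S then some (⟨p.1, h⟩, p.2) else none

theorem restrict_eq_none {M : TM0.Machine Γ Λ} {S : Finset Λ} (hS : TM0.Supports M (S : Set Λ))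
    (q : S) (a : Γ) : restrict M S q a = none ↔ M q a = none := by
  rw [restrict]
  rcases h : M q a with _ | ⟨q', s⟩
  · simp
  · have : q' ∈ S := hS.2 h q.2
    simp [this]

theorem restrict_eq_some {M : TM0.Machine Γ Λ} {S : Finset Λ} (hS : TM0.Supports M (S : Set Λ))
    {q : S} {a : Γ} {q' : Λ} {s : TM0.Stmt Γ} (h : M q a = some (q', s)) :
    ∃ h' : q' ∈ S, restrict M S q a = some (⟨q', h'⟩, s) := by
  have : q' ∈ S := hS.2 h q.2
  exact ⟨this, by simp [restrict, h, this]⟩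

variable [Inhabited Γ]

/-- The correspondence of configurations of a machine with those of its restriction. -/
def Corresponds {S : Finset Λ} (c : TM0.Cfg Γ Λ) (z : ZCfg Γ S) : Prop :=
  c.q = z.state ∧ ∀ i, c.Tape.nth i = z.tape (z.pos + i)

variable {M : TM0.Machine Γ Λ} {S : Finset Λ} {c c' : TM0.Cfg Γ Λ} {z : ZCfg Γ S}

theorem Corresponds.halted_iff (hS : TM0.Supports M (S : Set Λ)) (h : Corresponds c z) :
    z.Halted (restrict M S) ↔ TM0.step M c = none := by
  obtain ⟨q, T⟩ := c
  obtain ⟨h1, h2⟩ := h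
  simp only at h1 h2
  have h0 := h2 0
  rw [Tape.nth_zero, add_zero] at h0
  rw [ZCfg.Halted, restrict_eq_none hS, TM0.step, Option.map_eq_none_iff, h1, h0]

theorem Corresponds.step (hS : TM0.Supports M (S : Set Λ)) (h : Corresponds c z)
    (hc : TM0.step M c = some c') : Corresponds c' (z.step (restrict M S)) := by
  obtain ⟨q, T⟩ := c
  obtain ⟨h1, h2⟩ := h
  simp only at h1 h2
  have h0 := h2 0
  rw [Tape.nth_zero, add_zero] at h0
  rw [TM0.step] at hc
  obtain ⟨⟨q', s⟩, hM, rfl⟩ := Option.map_eq_some_iff.1 hc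
  rw [h1, h0] at hM
  obtain ⟨hq', hR⟩ := restrict_eq_some hS hM
  rw [ZCfg.step, hR]
  rcases s with (_ | _) | s
  · refine ⟨rfl, fun i => ?_⟩
    simp only [Tape.move_left_nth, h2]
    congr 1
    ring
  · refine ⟨rfl, fun i => ?_⟩
    simp only [Tape.move_right_nth, h2]
    congr 1
    ring
  · refine ⟨rfl, fun i => ?_⟩
    simp only [Tape.write_nth, h2, Function.update_apply]
    simp

theorem Tape.nth_mk₁ (L : List Γ) (i : ℤ) :
    (Tape.mk₁ L).nth i = if i < 0 then default else L.getI i.toNat := by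
  rcases lt_or_ge i 0 with hi | hi
  · rw [if_pos hi]
    obtain ⟨n, rfl⟩ : ∃ n : ℕ, i = -(n + 1 : ℕ) := ⟨(-i - 1).toNat, by omega⟩
    change (ListBlank.mk ([] : List Γ)).nth n = default
    rw [ListBlank.nth_mk]
    exact List.getI_nil n
  · rw [if_neg (by omega)]
    obtain ⟨n, rfl⟩ := Int.eq_ofNat_of_zero_le hi
    change (Tape.mk' _ _).nth n = _
    rw [Tape.mk'_nth_nat, ListBlank.nth_mk]
    rfl

/-- Step by step correspondence. Since halted configurations are fixed by `ZCfg.step`, the number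
`k` on the right may exceed the actual halting time. -/
theorem eval_dom_iff (hS : TM0.Supports M (S : Set Λ)) (L : List Γ) :
    (TM0.eval M L).Dom ↔ ∃ k, (letI : Inhabited S := ⟨⟨default, hS.1⟩⟩
      ((ZCfg.step (restrict M S))^[k] (ZCfg.init L)).Halted (restrict M S)) := by
  let _ : Inhabited S := ⟨⟨default, hS.1⟩⟩
  have h0 : Corresponds (TM0.init L : TM0.Cfg Γ Λ) (ZCfg.init L : ZCfg Γ S) := by
    refine ⟨rfl, fun i => ?_⟩
    simp only [TM0.init, ZCfg.init, zero_add]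
    exact Tape.nth_mk₁ L i
  change (StateTransition.eval (TM0.step M) (TM0.init L)).Dom ↔ _
  constructor
  · intro h
    obtain ⟨b, hb⟩ := Part.dom_iff_mem.1 h
    obtain ⟨hb1, hb2⟩ := StateTransition.mem_eval.1 hb
    have : ∃ k, Corresponds b ((ZCfg.step (restrict M S))^[k] (ZCfg.init L)) := by
      clear hb hb2
      induction hb1 with
      | refl => exact ⟨0, h0⟩
      | tail _ hs ih =>
        obtain ⟨k, hk⟩ := ih
        exact ⟨k + 1, by rw [Function.iterate_succ_apply']; exact hk.step hS hs⟩
    obtain ⟨k, hk⟩ := this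
    exact ⟨k, (hk.halted_iff hS).2 hb2⟩
  · rintro ⟨k, hk⟩
    have key : ∀ (k : ℕ) (c : TM0.Cfg Γ Λ) (z : ZCfg Γ S), Corresponds c z →
        ((ZCfg.step (restrict M S))^[k] z).Halted (restrict M S) →
          ∃ b, StateTransition.Reaches (TM0.step M) c b ∧ TM0.step M b = none := by
      intro k
      induction k with
      | zero => exact fun c z h h' => ⟨c, .refl, (h.halted_iff hS).1 h'⟩
      | succ k ih =>
        intro c z h h'
        rcases hc : TM0.step M c with _ | c'
        · exact ⟨c, .refl, hc⟩
        · rw [Function.iterate_succ_apply] at h'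
          obtain ⟨b, hb1, hb2⟩ := ih c' _ (h.step hS hc) h'
          exact ⟨b, .head hc hb1, hb2⟩
    obtain ⟨b, hb⟩ := key k _ _ h0 hk
    exact Part.dom_iff_mem.2 ⟨b, StateTransition.mem_eval.2 hb⟩

end Restrict

section Binary

/-- The successor on little-endian binary representations. -/
def incr (l : List Bool) : List Bool :=
  List.recOn l [true] fun b l ih => bif b then false :: ih else true :: l

theorem primrec_incr : Primrec incr := by
  refine Primrec.list_rec (h := fun _ p => bif p.1 then false :: p.2.2 else true :: p.2.1)
    Primrec.id (Primrec.const [true]) ?_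
  refine Primrec.cond (Primrec.fst.comp Primrec.snd) ?_ ?_
  · exact Primrec.list_cons.comp (Primrec.const false)
      (Primrec.snd.comp (Primrec.snd.comp Primrec.snd))
  · exact Primrec.list_cons.comp (Primrec.const true)
      (Primrec.fst.comp (Primrec.snd.comp Primrec.snd))

open PartrecToTM2

/-- The symbol that represents a bit. -/
def bitSymbol (b : Bool) : Γ' := bif b then .bit1 else .bit0

theorem exists_trPosNum_eq (p : PosNum) : ∃ l : List Bool, trPosNum p = l.map bitSymbol ∧
    trPosNum p.succ = (incr l).map bitSymbol := by
  induction p with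
  | one => exact ⟨[true], rfl, rfl⟩
  | bit1 p ih =>
    obtain ⟨l, h1, h2⟩ := ih
    refine ⟨true :: l, by simp [trPosNum, h1, bitSymbol], ?_⟩
    change Γ'.bit0 :: trPosNum p.succ = _
    rw [h2]
    rfl
  | bit0 p ih =>
    obtain ⟨l, h1, -⟩ := ih
    refine ⟨false :: l, by simp [trPosNum, h1, bitSymbol], ?_⟩
    change Γ'.bit1 :: trPosNum p = _
    rw [h1]
    rfl

theorem bitSymbol_injective : Function.Injective bitSymbol := by
  intro a b h
  cases a <;> cases b <;> simp_all [bitSymbol]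

/-- Binary notation as an iterated successor on bit lists makes the machine's input visibly
primitive recursive in `n`. -/
theorem trNat_eq (n : ℕ) : trNat n = (incr^[n] []).map bitSymbol := by
  induction n with
  | zero => simp
  | succ n ih =>
    rw [Function.iterate_succ_apply']
    rw [trNat] at ih ⊢
    rw [Nat.cast_succ, Num.add_one]
    rcases h : (n : Num) with _ | p
    · rw [h] at ih
      have : incr^[n] [] = [] := by simpa [trNum] using ih.symm
      rw [this]
      rfl
    · rw [h] at ih
      obtain ⟨l, h1, h2⟩ := exists_trPosNum_eq p
      change trPosNum p = _ at ih
      rw [h1] at ih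
      rw [← List.map_injective_iff.2 bitSymbol_injective ih]
      exact h2

end Binary

/-- A code for the partial function that evaluates the `n`-th program at `0`; deciding its domain
would decide the halting problem. -/
theorem exists_undecidable_code : ∃ c : ToPartrec.Code,
    ¬ ComputablePred fun n : ℕ => (c.eval [n]).Dom := by
  have hp : Partrec fun n : ℕ => Nat.Partrec.Code.eval (Denumerable.ofNat Nat.Partrec.Code n) 0 :=
    Nat.Partrec.Code.eval_part.comp (Computable.ofNat _) (Computable.const 0)
  obtain ⟨c, hc⟩ := ToPartrec.Code.exists_code (Nat.Partrec'.part_iff₁.2 hp)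
  refine ⟨c, fun h => ComputablePred.halting_problem 0 ?_⟩
  have hr : (fun c : Nat.Partrec.Code => (c.eval 0).Dom) ≤₀ fun n : ℕ => (c.eval [n]).Dom := by
    refine ⟨Encodable.encode, Computable.encode, fun d => ?_⟩
    have := hc (Encodable.encode d ::ᵥ List.Vector.nil)
    change c.eval [Encodable.encode d] = _ at this
    change (d.eval 0).Dom ↔ (c.eval [Encodable.encode d]).Dom
    rw [this, List.Vector.head_cons, Denumerable.ofNat_encode]
    rfl
  exact ComputablePred.computable_of_manyOneReducible hr h

/-- There is a Turing machine with finitely many symbols and states for which it is undecidable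
whether it halts on the input that represents a given number. -/
theorem exists_undecidable_machine : ∃ (Γ Λ : Type) (_ : Fintype Γ) (_ : Fintype Λ)
    (_ : Inhabited Γ) (_ : Inhabited Λ) (M : Λ → Γ → Option (Λ × TM0.Stmt Γ)) (inp : ℕ → List Γ),
    (∀ e : Γ → ℕ, Primrec fun n => (inp n).map e) ∧
      ¬ ComputablePred fun n => ∃ k, ((ZCfg.step M)^[k] (ZCfg.init (inp n))).Halted M := by
  classical
  obtain ⟨c, hc⟩ := exists_undecidable_code
  let _ : Inhabited PartrecToTM2.Λ' := ⟨PartrecToTM2.trNormal c PartrecToTM2.Cont'.halt⟩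
  -- The code is compiled to `TM2`, `TM1` and `TM0` machines. The label types are not known to be
  -- finite, but each compilation comes with a finite supporting set, to which the last machine is
  -- restricted.
  have h2 := PartrecToTM2.tr_supports c PartrecToTM2.Cont'.halt
  have h1 := TM2to1.tr_supports _ h2
  have h0 := TM1to0.tr_supports _ h1
  let _ : Fintype PartrecToTM2.K' :=
    ⟨{.main, .rev, .aux, .stack}, fun k => by cases k <;> simp⟩
  let T : TM0.Machine _ _ := TM1to0.tr (TM2to1.tr PartrecToTM2.tr)
  let S := TM1to0.trStmts (TM2to1.tr PartrecToTM2.tr)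
    (TM2to1.trSupp PartrecToTM2.tr (PartrecToTM2.codeSupp c PartrecToTM2.Cont'.halt))
  let inp : ℕ → List (TM2to1.Γ' PartrecToTM2.K' fun _ => PartrecToTM2.Γ') := fun n =>
    TM2to1.trInit PartrecToTM2.K'.main (PartrecToTM2.trList [n])
  refine ⟨_, S, TM2to1.Γ'.fintype, inferInstance, inferInstance, ⟨⟨default, h0.1⟩⟩, restrict T S, inp,
    ?_, ?_⟩
  -- As the alphabet carries no numbering, primitive recursiveness is tested through every map `e`
  -- to `ℕ`. The input is the reversed binary word, preceded by the separator with the bottom mark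
  -- `true`.
  · intro e
    let φ : PartrecToTM2.Γ' → TM2to1.Γ' PartrecToTM2.K' (fun _ => PartrecToTM2.Γ') := fun a =>
      (false, Function.update (fun _ => none) PartrecToTM2.K'.main (some a))
    have hinp : ∀ n, (inp n).map e = e (true, (φ .cons).2) ::
        ((incr^[n] []).reverse.map fun b => e (φ (bitSymbol b))) := by
      intro n
      have key : ∀ l : List PartrecToTM2.Γ',
          (TM2to1.trInit PartrecToTM2.K'.main (l ++ [.cons])).map e =
            e (true, (φ .cons).2) :: l.reverse.map fun a => e (φ a) := by
        intro l
        change ((true, ((l ++ [PartrecToTM2.Γ'.cons]).reverse.map φ).headI.2) ::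
          ((l ++ [PartrecToTM2.Γ'.cons]).reverse.map φ).tail).map e = _
        rw [List.reverse_append]
        exact congrArg (List.cons _) List.map_map
      change (TM2to1.trInit PartrecToTM2.K'.main (PartrecToTM2.trNat n ++ [.cons])).map e = _
      rw [key, trNat_eq, ← List.map_reverse, List.map_map]
      rfl
    simp only [hinp]
    refine Primrec.list_cons.comp (Primrec.const _) (Primrec.list_map (Primrec.list_reverse.comp ?_)
      ((Primrec.dom_finite fun b => e (φ (bitSymbol b))).comp Primrec.snd))
    exact Primrec.nat_iterate Primrec.id (Primrec.const _) (primrec_incr.comp Primrec.snd)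
  · intro h
    refine hc (h.of_eq fun n => ?_)
    rw [← eval_dom_iff h0 (inp n), TM1to0.tr_eval]
    refine (TM2to1.tr_eval_dom _ _ _).trans ?_
    have hinit : (TM2.init PartrecToTM2.K'.main (PartrecToTM2.trList [n]) : PartrecToTM2.Cfg') =
        PartrecToTM2.init c [n] := by
      unfold TM2.init PartrecToTM2.init
      congr 1
      funext k
      cases k <;> rfl
    change (StateTransition.eval (TM2.step PartrecToTM2.tr) (TM2.init _ _)).Dom ↔ _
    rw [hinit, PartrecToTM2.tr_eval]
    rfl

end TimedAutomata
-- Tiles: from cells to letters of the automaton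
namespace TimedAutomata

open Turing

/-- Tiles, numbered by `0, …, size - 1`, with compatibility relations and labels. -/
structure TileSystem where
  size : ℕ
  halt : List ℕ
  next : List (ℕ × ℕ)
  copy : List (ℕ × ℕ)
  label : List ℕ

/-- The checker for spirals of tiles whose first turn follows the word `w` of labels. The internal
letters are the tiles, `size` is the only return, and the calls are the positions in `w`. -/
def TileSystem.checker (S : TileSystem) (w : List ℕ) : Checker where
  letters := S.size + 1 + w.length
  kind a := if a < S.size then 1 else if a = S.size then 2 else 0
  first a := decide (a = S.size + 1)
  halt a := decide (a ∈ S.halt)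
  -- The call `S.size + 1 + i` stands for position `i` of `w`. Only positions `1` and `w.length - 1`
  -- may be repeated (the padding), and only the last may be followed by a tile or a return.
  next a b := decide ((a, b) ∈ S.next ∨ (a ≤ S.size ∧ b = S.size) ∨ (S.size < a ∧
    (b = a + 1 ∨ (b = a ∧ (a = S.size + 2 ∨ a = S.size + w.length)) ∨
      (b ≤ S.size ∧ a = S.size + w.length))))
  -- A return is a correct copy of everything, which lets the computation stop after any cell.
  copy a b := decide (b = S.size ∨ (a, b) ∈ S.copy ∨
    (S.size < a ∧ b < S.size ∧ S.label.getD b 0 = w.getD (a - S.size - 1) 0))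

section Tiles

variable {Γ Λ : Type} [Fintype Γ] [Fintype Λ]

abbrev Tile (Γ Λ : Type) : Type := Cell Γ Λ × Cell Γ Λ × Cell Γ Λ

noncomputable def cellNum (b : Cell Γ Λ) : ℕ := Fintype.equivFin (Cell Γ Λ) b

noncomputable def tileNum (t : Tile Γ Λ) : ℕ := Fintype.equivFin (Tile Γ Λ) t

theorem cellNum_injective : Function.Injective (cellNum : Cell Γ Λ → ℕ) :=
  Fin.val_injective.comp (Fintype.equivFin _).injective

theorem tileNum_injective : Function.Injective (tileNum : Tile Γ Λ → ℕ) :=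
  Fin.val_injective.comp (Fintype.equivFin _).injective

theorem tileNum_lt (t : Tile Γ Λ) : tileNum t < Fintype.card (Tile Γ Λ) :=
  (Fintype.equivFin (Tile Γ Λ) t).2

theorem exists_tileNum_eq {a : ℕ} (ha : a < Fintype.card (Tile Γ Λ)) :
    ∃ t : Tile Γ Λ, tileNum t = a :=
  ⟨(Fintype.equivFin _).symm ⟨a, ha⟩, by simp [tileNum]⟩

open Classical in
/-- The tiles formed by three consecutive cells. -/
noncomputable def tileSystem (M : Λ → Γ → Option (Λ × TM0.Stmt Γ)) : TileSystem where
  size := Fintype.card (Tile Γ Λ)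
  halt := ((Finset.univ.filter fun t : Tile Γ Λ => HaltedCell M t.2.1).image tileNum).toList
  next := ((Finset.univ.filter fun t : Tile Γ Λ × Tile Γ Λ =>
    t.1.2.1 = t.2.1 ∧ t.1.2.2 = t.2.2.1).image fun t => (tileNum t.1, tileNum t.2)).toList
  copy := ((Finset.univ.filter fun t : Tile Γ Λ × Tile Γ Λ =>
    rule M t.1.1 t.1.2.1 t.1.2.2 = some t.2.2.1).image fun t => (tileNum t.1, tileNum t.2)).toList
  label := List.ofFn fun i => cellNum ((Fintype.equivFin (Tile Γ Λ)).symm i).2.1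

variable {M : Λ → Γ → Option (Λ × TM0.Stmt Γ)}

theorem tileNum_mem_halt {t : Tile Γ Λ} :
    tileNum t ∈ (tileSystem M).halt ↔ HaltedCell M t.2.1 := by
  simp only [tileSystem, Finset.mem_toList, Finset.mem_image, Finset.mem_filter, Finset.mem_univ,
    true_and]
  exact ⟨fun ⟨t', h, e⟩ => tileNum_injective e ▸ h, fun h => ⟨t, h, rfl⟩⟩

theorem lt_of_mem_halt {a : ℕ} (h : a ∈ (tileSystem M).halt) : a < (tileSystem M).size := by
  simp only [tileSystem, Finset.mem_toList, Finset.mem_image] at h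
  obtain ⟨t, -, rfl⟩ := h
  exact tileNum_lt t

theorem tileNum_mem_next {t t' : Tile Γ Λ} : (tileNum t, tileNum t') ∈ (tileSystem M).next ↔
    t.2.1 = t'.1 ∧ t.2.2 = t'.2.1 := by
  simp only [tileSystem, Finset.mem_toList, Finset.mem_image, Finset.mem_filter, Finset.mem_univ,
    true_and, Prod.mk.injEq]
  constructor
  · rintro ⟨⟨_, _⟩, h, e, e'⟩
    rw [← tileNum_injective e, ← tileNum_injective e']
    exact h
  · exact fun h => ⟨(t, t'), h, rfl, rfl⟩

theorem lt_of_mem_next {a b : ℕ} (h : (a, b) ∈ (tileSystem M).next) :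
    a < (tileSystem M).size ∧ b < (tileSystem M).size := by
  simp only [tileSystem, Finset.mem_toList, Finset.mem_image, Prod.mk.injEq] at h
  obtain ⟨t, -, rfl, rfl⟩ := h
  exact ⟨tileNum_lt _, tileNum_lt _⟩

theorem tileNum_mem_copy {t t' : Tile Γ Λ} : (tileNum t, tileNum t') ∈ (tileSystem M).copy ↔
    rule M t.1 t.2.1 t.2.2 = some t'.2.1 := by
  simp only [tileSystem, Finset.mem_toList, Finset.mem_image, Finset.mem_filter, Finset.mem_univ,
    true_and, Prod.mk.injEq]
  constructor
  · rintro ⟨⟨_, _⟩, h, e, e'⟩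
    rw [← tileNum_injective e, ← tileNum_injective e']
    exact h
  · exact fun h => ⟨(t, t'), h, rfl, rfl⟩

theorem lt_of_mem_copy {a b : ℕ} (h : (a, b) ∈ (tileSystem M).copy) :
    a < (tileSystem M).size ∧ b < (tileSystem M).size := by
  simp only [tileSystem, Finset.mem_toList, Finset.mem_image, Prod.mk.injEq] at h
  obtain ⟨t, -, rfl, rfl⟩ := h
  exact ⟨tileNum_lt _, tileNum_lt _⟩

theorem label_tileNum (t : Tile Γ Λ) :
    (tileSystem M).label.getD (tileNum t) 0 = cellNum t.2.1 := by
  have h := tileNum_lt t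
  rw [tileSystem, List.getD_eq_getElem?_getD, List.getElem?_ofFn, dif_pos h]
  simp [tileNum]

theorem kind_le_of_next {w : List ℕ} {a b : ℕ} (h : ((tileSystem M).checker w).next a b = true) :
    ((tileSystem M).checker w).kind a ≤ ((tileSystem M).checker w).kind b := by
  simp only [TileSystem.checker, decide_eq_true_eq] at h ⊢
  rcases h with h | ⟨h1, rfl⟩ | ⟨h1, h2⟩
  · obtain ⟨h1, h2⟩ := lt_of_mem_next h
    rw [if_pos h1, if_pos h2]
  · rw [if_neg (lt_irrefl _), if_pos rfl]
    split_ifs <;> omega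
  · rw [if_neg (by omega), if_neg (by omega)]
    exact Nat.zero_le _

theorem one_le_kind_of_copy {w : List ℕ} {a b : ℕ}
    (h : ((tileSystem M).checker w).copy a b = true) :
    1 ≤ ((tileSystem M).checker w).kind b := by
  simp only [TileSystem.checker, decide_eq_true_eq] at h ⊢
  rcases h with rfl | h | ⟨-, h, -⟩
  · rw [if_neg (lt_irrefl _), if_pos rfl]
    omega
  · rw [if_pos (lt_of_mem_copy h).2]
  · rw [if_pos h]

/-- The relation `copy` compares two letters, whereas the local rule needs three cells; overlapping
triples carry the neighbours along, and the middle components form the sequence of cells. -/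
theorem exists_isCellSpiral_of_isSpiral {w : List (Cell Γ Λ)} (hw : w[0]? = some none) {n m : ℕ}
    {x : ℕ → ℕ} (h : ((tileSystem M).checker (w.map cellNum)).IsSpiral n m x) :
    ∃ j y, IsCellSpiral M w n m j y := by
  classical
  set S := tileSystem M
  have hSn : ∀ {a b}, (a, b) ∈ S.next → a < S.size ∧ b < S.size := lt_of_mem_next
  have hSc : ∀ {a b}, (a, b) ∈ S.copy → a < S.size ∧ b < S.size := lt_of_mem_copy
  have hn := h.pos
  have hlt : ∀ p < n + m + n, x p < S.size + 1 + w.length := by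
    simpa [TileSystem.checker] using h.lt
  have hfirst : x 0 = S.size + 1 := by simpa [TileSystem.checker] using h.first
  have hcall : ∀ p < n, S.size < x p := by
    intro p hp
    have := h.kind_call p hp
    simp only [TileSystem.checker] at this
    split_ifs at this
    omega
  have hint : ∀ p, n ≤ p → p < n + m → x p < S.size := by
    intro p hp hp'
    have := h.kind_int p hp hp'
    simp only [TileSystem.checker] at this
    split_ifs at this
    · assumption
    · omega
  have hnext := h.next
  have hcopy := h.copy
  simp only [TileSystem.checker, decide_eq_true_eq, List.length_map] at hnext hcopy
  obtain ⟨q, hq, hqh⟩ := h.halt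
  simp only [TileSystem.checker, decide_eq_true_eq] at hqh
  have hqs : x q < S.size := lt_of_mem_halt hqh
  have hqn : n ≤ q := by
    by_contra! hh
    have := hcall q hh
    omega
  have hqm : q < n + m := by
    by_contra! hh
    have := h.kind_ret q hh hq
    simp only [TileSystem.checker] at this
    rw [if_pos hqs] at this
    omega
  have htile : ∀ p, ∃ t : Tile Γ Λ, p < m → tileNum t = x (n + p) := by
    intro p
    by_cases hp : p < m
    · obtain ⟨t, ht⟩ := exists_tileNum_eq (Γ := Γ) (Λ := Λ) (hint (n + p) (by omega) (by omega))
      exact ⟨t, fun _ => ht⟩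
    · exact ⟨(none, none, none), fun h => absurd h hp⟩
  choose t ht using htile
  have hadj : ∀ p, p + 1 < m → (t p).2.1 = (t (p + 1)).1 ∧ (t p).2.2 = (t (p + 1)).2.1 := by
    intro p hp
    have h1 := hint (n + p) (by omega) (by omega)
    have h2 := hint (n + p + 1) (by omega) (by omega)
    rcases hnext (n + p) (by omega) with H | H | H
    · rw [add_assoc, ← ht p (by omega), ← ht (p + 1) hp, tileNum_mem_next] at H
      exact H
    · omega
    · omega
  have hinit : ∀ p < n, p < m → w[x p - S.size - 1]? = some (t p).2.1 := by
    intro p hp hpm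
    have h1 := hcall p hp
    have h2 := hint (n + p) (by omega) (by omega)
    have h3 := hlt p (by omega)
    have H := hcopy p (by omega)
    rw [add_comm p n] at H
    rcases H with H | H | ⟨-, -, H⟩
    · omega
    · have := (hSc H).1
      omega
    · rw [← ht p hpm, label_tileNum] at H
      have hj : x p - S.size - 1 < w.length := by omega
      rw [List.getD_eq_getElem?_getD, List.getElem?_map, List.getElem?_eq_getElem hj] at H
      rw [List.getElem?_eq_getElem hj]
      exact congrArg some (cellNum_injective H).symm
  refine ⟨fun p => x p - S.size - 1, fun p => (t p).2.1, hn, ?_, ?_, ?_, hinit, ?_, ?_⟩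
  · simp [hfirst]
  · intro p hp
    have h1 := hcall p (by omega)
    have h2 := hcall (p + 1) hp
    rcases hnext p (by omega) with H | H | H
    · have := (hSn H).1
      omega
    · omega
    · omega
  · have h1 := hcall (n - 1) (by omega)
    have h2 := hint n le_rfl (by omega)
    have H := hnext (n - 1) (by omega)
    rw [Nat.sub_add_cancel hn] at H
    rcases H with H | H | H
    · have := (hSn H).1
      omega
    · omega
    · have := hlt (n - 1) (by omega)
      omega
  · intro p hp
    have h1 := hint (n + p) (by omega) (by omega)
    have h2 := hint (n + p + n) (by omega) (by omega)
    have H : rule M (t p).1 (t p).2.1 (t p).2.2 = some (t (p + n)).2.1 := by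
      rcases hcopy (n + p) (by omega) with H | H | H
      · omega
      · rwa [add_assoc, ← ht p (by omega), ← ht (p + n) hp, tileNum_mem_copy] at H
      · omega
    have h4 := (hadj p (by omega)).2
    -- The left component of the very first tile is unconstrained; its middle is the wall `w[0]`,
    -- for which the rule ignores the neighbours.
    rcases Nat.eq_zero_or_pos p with rfl | hp0
    · have h3 := hinit 0 hn (by omega)
      rw [hfirst, show S.size + 1 - S.size - 1 = 0 by omega, hw] at h3
      have h3' := (Option.some_injective _ h3).symm
      rw [h3'] at H
      exact (congrArg (fun b => rule M _ b _) h3').trans H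
    · have h3 := (hadj (p - 1) (by omega)).1
      rw [Nat.sub_add_cancel hp0] at h3
      rw [← h3, h4] at H
      exact H
  · refine ⟨q - n, by omega, ?_⟩
    have := ht (q - n) (by omega)
    rw [show n + (q - n) = q by omega] at this
    rw [← this, tileNum_mem_halt] at hqh
    exact hqh

theorem exists_isSpiral_of_isCellSpiral {w : List (Cell Γ Λ)} {n m : ℕ} {j : ℕ → ℕ}
    {y : ℕ → Cell Γ Λ} (h : IsCellSpiral M w n m j y) :
    ∃ x, ((tileSystem M).checker (w.map cellNum)).IsSpiral n m x := by
  set S := tileSystem M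
  have hn := h.pos
  have hj : ∀ p < n, j p < w.length := by
    have hmono : ∀ p q, p ≤ q → q < n → j p ≤ j q := by
      intro p q hpq
      induction q, hpq using Nat.le_induction with
      | base => exact fun _ => le_rfl
      | succ q hq ih =>
        intro hq'
        have := ih (by omega)
        have := h.step q hq'
        omega
    intro p hp
    have := hmono p (n - 1) (by omega) (by omega)
    have := h.last
    omega
  let t : ℕ → Tile Γ Λ := fun p => (y (p - 1), y p, y (p + 1))
  have htS : ∀ p, tileNum (t p) < S.size := fun p => tileNum_lt _
  let x : ℕ → ℕ := fun p => if p < n then S.size + 1 + j p else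
    if p < n + m then tileNum (t (p - n)) else S.size
  have hx1 : ∀ p < n, x p = S.size + 1 + j p := fun p hp => if_pos hp
  have hx2 : ∀ p < m, x (n + p) = tileNum (t p) := by
    intro p hp
    simp only [x]
    rw [if_neg (by omega), if_pos (by omega), Nat.add_sub_cancel_left]
  have hx3 : ∀ p, n + m ≤ p → x p = S.size := by
    intro p hp
    simp only [x]
    rw [if_neg (by omega), if_neg (by omega)]
  obtain ⟨q, hq, hqh⟩ := h.halt
  refine ⟨x, hn, ?_, ?_, ?_, ?_, ?_, ?_, ?_, ?_⟩
  · intro p hp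
    simp only [TileSystem.checker, List.length_map]
    rcases lt_or_ge p n with h1 | h1
    · rw [hx1 p h1]
      have := hj p h1
      omega
    · obtain ⟨i, rfl⟩ := Nat.exists_eq_add_of_le h1
      rcases lt_or_ge i m with h2 | h2
      · rw [hx2 i h2]
        have := htS i
        omega
      · rw [hx3 _ (by omega)]
        omega
  · simp [TileSystem.checker, hx1 0 hn, h.zero]
  · refine ⟨n + q, by omega, ?_⟩
    simp only [TileSystem.checker, decide_eq_true_eq]
    rw [hx2 q hq]
    exact tileNum_mem_halt.2 hqh
  · intro p hp
    simp only [TileSystem.checker, hx1 p hp]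
    rw [if_neg (by omega), if_neg (by omega)]
  · intro p hp hp'
    obtain ⟨i, rfl⟩ := Nat.exists_eq_add_of_le hp
    simp only [TileSystem.checker, hx2 i (by omega)]
    rw [if_pos (htS i)]
  · intro p hp _
    simp only [TileSystem.checker, hx3 p hp]
    simp
  · intro p hp
    simp only [TileSystem.checker, decide_eq_true_eq, List.length_map]
    rcases lt_or_ge (p + 1) n with h1 | h1
    · right; right
      rw [hx1 p (by omega), hx1 _ h1]
      have := h.step p h1
      omega
    rcases Nat.eq_or_lt_of_le h1 with h2 | h2
    · right; right
      have hle : x (p + 1) ≤ S.size := by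
        rcases Nat.eq_zero_or_pos m with rfl | hm
        · omega
        · rw [← h2, ← add_zero n, hx2 0 hm]
          exact (htS 0).le
      have := h.last
      rw [show n - 1 = p by omega] at this
      rw [hx1 p (by omega)]
      omega
    obtain ⟨i, rfl⟩ := Nat.exists_eq_add_of_le (show n ≤ p by omega)
    rcases lt_or_ge (i + 1) m with h3 | h3
    · left
      rw [add_assoc, hx2 i (by omega), hx2 _ h3]
      exact tileNum_mem_next.2 ⟨rfl, rfl⟩
    · right; left
      refine ⟨?_, hx3 _ (by omega)⟩
      rcases lt_or_ge i m with h4 | h4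
      · rw [hx2 i h4]
        exact (htS i).le
      · rw [hx3 _ (by omega)]
  · intro p hp
    simp only [TileSystem.checker, decide_eq_true_eq]
    rcases lt_or_ge p m with h1 | h1
    · right
      rw [add_comm p n, hx2 p h1]
      rcases lt_or_ge p n with h2 | h2
      · right
        refine ⟨by rw [hx1 p h2]; omega, htS p, ?_⟩
        rw [label_tileNum, hx1 p h2, show S.size + 1 + j p - S.size - 1 = j p by omega,
          List.getD_eq_getElem?_getD, List.getElem?_map, h.init p h2 h1]
        rfl
      · left
        obtain ⟨i, rfl⟩ := Nat.exists_eq_add_of_le h2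
        rw [hx2 i (by omega), tileNum_mem_copy, add_comm n i]
        exact h.copy i (by omega)
    · left
      exact hx3 _ (by omega)

theorem not_isUniversal_iff_halts [Inhabited Γ] [Inhabited Λ] (L : List Γ) :
    ¬ ((tileSystem M).checker ((initWord L : List (Cell Γ Λ)).map cellNum)).code.toAutomaton.IsUniversal
      ↔ ∃ k, ((ZCfg.step M)^[k] (ZCfg.init L)).Halted M := by
  rw [Checker.not_isUniversal_iff_exists_isSpiral (fun _ _ => kind_le_of_next)
    (fun _ _ => one_le_kind_of_copy)]
  constructor
  · rintro ⟨n, m, x, hx⟩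
    obtain ⟨j, y, hy⟩ := exists_isCellSpiral_of_isSpiral (getElem?_initWord L (by omega)) hx
    exact hy.exists_halted
  · rintro ⟨k, hk⟩
    obtain ⟨n, m, j, y, hy⟩ := exists_isCellSpiral hk
    obtain ⟨x, hx⟩ := exists_isSpiral_of_isCellSpiral hy
    exact ⟨n, m, x, hx⟩

end Tiles

end TimedAutomata
-- The reduction is primitive recursive
namespace TimedAutomata

open Turing

section Primitive

variable {α : Type} [Primcodable α]

theorem primrecPred_mem {β : Type} [Primcodable β] (l : List β) {f : α → β} (hf : Primrec f) :
    PrimrecPred fun a => f a ∈ l := by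
  have h := (PrimrecRel.exists_mem_list (Primrec.eq (α := β))).comp (Primrec.const l) hf
  exact h.of_eq fun a => by simp

variable (S : TileSystem)

theorem primrec_checker_kind {w : α → List ℕ} {a : α → ℕ} (ha : Primrec a) :
    Primrec fun x => (S.checker (w x)).kind (a x) :=
  Primrec.ite (Primrec.nat_lt.comp ha (Primrec.const _)) (Primrec.const 1)
    (Primrec.ite (Primrec.eq.comp ha (Primrec.const _)) (Primrec.const 2) (Primrec.const 0))

theorem primrec_checker_next {w : α → List ℕ} {a b : α → ℕ} (hw : Primrec w) (ha : Primrec a)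
    (hb : Primrec b) : Primrec fun x => (S.checker (w x)).next (a x) (b x) := by
  have hs : Primrec fun _ : α => S.size := Primrec.const _
  have hl : Primrec fun x => S.size + (w x).length :=
    Primrec.nat_add.comp hs (Primrec.list_length.comp hw)
  refine PrimrecPred.decide ?_
  refine (primrecPred_mem S.next (Primrec.pair ha hb)).or (((Primrec.nat_le.comp ha hs).and
    (Primrec.eq.comp hb hs)).or ((Primrec.nat_lt.comp hs ha).and
    ((Primrec.eq.comp hb (Primrec.succ.comp ha)).or (((Primrec.eq.comp hb ha).and
      ((Primrec.eq.comp ha (Primrec.const _)).or (Primrec.eq.comp ha hl))).or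
      ((Primrec.nat_le.comp hb hs).and (Primrec.eq.comp ha hl))))))

theorem primrec_checker_copy {w : α → List ℕ} {a b : α → ℕ} (hw : Primrec w) (ha : Primrec a)
    (hb : Primrec b) : Primrec fun x => (S.checker (w x)).copy (a x) (b x) := by
  have hs : Primrec fun _ : α => S.size := Primrec.const _
  refine PrimrecPred.decide ?_
  refine (Primrec.eq.comp hb hs).or ((primrecPred_mem S.copy (Primrec.pair ha hb)).or
    ((Primrec.nat_lt.comp hs ha).and ((Primrec.nat_lt.comp hb hs).and (Primrec.eq.comp
      ((Primrec.list_getD 0).comp (Primrec.const _) hb)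
      ((Primrec.list_getD 0).comp hw (Primrec.nat_sub.comp (Primrec.nat_sub.comp ha hs)
        (Primrec.const 1)))))))

theorem primrec_ops : Primrec Checker.ops := by
  refine (Primrec.ite (c := fun k => k = 0) (Primrec.eq.comp Primrec.id (Primrec.const 0))
    (Primrec.const [.push 0]) (Primrec.ite (c := fun k => k = 1)
      (Primrec.eq.comp Primrec.id (Primrec.const 1))
    (Primrec.const [.noop]) (Primrec.const [.pop 0, .emptyTest]))).of_eq fun k => ?_
  match k with
  | 0 => rfl
  | 1 => rfl
  | k + 2 => rfl

theorem primrec_edgeCode {s l t : α → ℕ} {g : α → List (ℕ × Cmp × ℕ)} {o : α → StackOp ℕ}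
    {r : α → List ℕ} (hs : Primrec s) (hl : Primrec l) (hg : Primrec g) (ho : Primrec o)
    (hr : Primrec r) (ht : Primrec t) :
    Primrec fun x => (⟨s x, l x, g x, o x, r x, t x⟩ : EdgeCode) :=
  (Primrec.of_equiv_symm (e := EdgeCode.equivProd)).comp
    (hs.pair (hl.pair (hg.pair (ho.pair (hr.pair ht)))))

theorem primrec_rules {w : α → List ℕ} {a b : α → ℕ} (hw : Primrec w) (ha : Primrec a)
    (hb : Primrec b) : Primrec fun x => (S.checker (w x)).rules (a x) (b x) := by
  have lin : ∀ (c : ℕ) {f : α → ℕ}, Primrec f → Primrec fun x => c + 2 * f x := fun c f hf =>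
    Primrec.nat_add.comp (Primrec.const c) (Primrec.nat_mul.comp (Primrec.const 2) hf)
  have one : ∀ {f : α → ℕ × List (ℕ × Cmp × ℕ) × List ℕ × ℕ}, Primrec f → Primrec fun x => [f x] :=
    fun hf => Primrec.list_cons.comp hf (Primrec.const [])
  have mk : ∀ (g : List (ℕ × Cmp × ℕ)) (r : List ℕ) {s t : α → ℕ}, Primrec s → Primrec t →
      Primrec fun x => (s x, g, r, t x) := fun g r s t hs ht =>
    hs.pair ((Primrec.const g).pair ((Primrec.const r).pair ht))
  have k : ∀ n : ℕ, Primrec fun _ : α => n := Primrec.const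
  have nil : Primrec fun _ : α => ([] : List (ℕ × List (ℕ × Cmp × ℕ) × List ℕ × ℕ)) :=
    Primrec.const []
  refine Primrec.list_append.comp ?_ (Primrec.list_append.comp ?_ (Primrec.list_append.comp ?_
    (Primrec.list_append.comp ?_ (Primrec.list_append.comp ?_ ?_))))
  · exact Primrec.list_cons.comp (mk _ _ (k 1) (k 1)) (Primrec.list_cons.comp (mk _ _ (k 2) (k 2))
      (Primrec.list_cons.comp (mk _ _ (k 2) (lin 4 ha)) (Primrec.list_cons.comp
      (mk _ _ (lin 4 hb) (k 1)) (Primrec.list_cons.comp (mk _ _ (lin 5 hb) (lin 5 hb))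
      (one (mk _ _ (lin 5 hb) (lin 5 hb)))))))
  · exact Primrec.cond (PrimrecPred.decide (Primrec.eq.comp ha (k _))) nil
      (one (mk _ _ (k 0) (k 1)))
  · exact Primrec.cond (PrimrecPred.decide (primrecPred_mem _ ha)) nil (one (mk _ _ (k 3) (k 3)))
  · exact Primrec.cond (PrimrecPred.decide (Primrec.nat_lt.comp (primrec_checker_kind S ha) (k 2)))
      (one (mk _ _ (k 2) (lin 5 ha))) nil
  · exact Primrec.cond (primrec_checker_next S hw hb ha) nil (one (mk _ _ (lin 4 hb) (k 1)))
  · exact Primrec.cond (primrec_checker_copy S hw hb ha) nil (one (mk _ _ (lin 5 hb) (lin 5 hb)))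

theorem primrec_edges : Primrec fun w => (S.checker w).edges := by
  have hl : Primrec fun w : List ℕ => (S.checker w).letters :=
    Primrec.nat_add.comp (Primrec.const _) Primrec.list_length
  refine Primrec.list_flatMap (Primrec.list_range.comp hl) ?_
  refine Primrec.list_append.comp ?_ ?_
  · refine Primrec.list_flatMap (Primrec.list_range.comp (hl.comp Primrec.fst)) ?_
    have hw : Primrec fun x : (List ℕ × ℕ) × ℕ => x.1.1 := Primrec.fst.comp Primrec.fst
    have ha : Primrec fun x : (List ℕ × ℕ) × ℕ => x.1.2 := Primrec.snd.comp Primrec.fst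
    refine Primrec.list_flatMap (primrec_rules S hw ha Primrec.snd) ?_
    refine Primrec.list_map (primrec_ops.comp (primrec_checker_kind S (ha.comp Primrec.fst))) ?_
    have hr : Primrec fun x : (((List ℕ × ℕ) × ℕ) × (ℕ × List (ℕ × Cmp × ℕ) × List ℕ × ℕ)) ×
      StackOp ℕ => x.1.2 := Primrec.snd.comp Primrec.fst
    exact primrec_edgeCode (Primrec.fst.comp hr) (ha.comp (Primrec.fst.comp Primrec.fst))
      (Primrec.fst.comp (Primrec.snd.comp hr)) Primrec.snd
      (Primrec.fst.comp (Primrec.snd.comp (Primrec.snd.comp hr)))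
      (Primrec.snd.comp (Primrec.snd.comp (Primrec.snd.comp hr)))
  · refine Primrec.cond (PrimrecPred.decide (Primrec.nat_lt.comp
      (primrec_checker_kind S Primrec.snd) (Primrec.const 2))) (Primrec.const [])
      (Primrec.list_cons.comp ?_ (Primrec.const []))
    exact primrec_edgeCode (Primrec.const _) Primrec.snd (Primrec.const _) (Primrec.const _)
      (Primrec.const _) (Primrec.const _)

/-- The tile system belongs to the fixed machine, so its tables are constants; only the word `w`
varies with the input. -/
theorem primrec_code : Primrec fun w => (S.checker w).code := by
  have hl : Primrec fun w : List ℕ => (S.checker w).letters :=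
    Primrec.nat_add.comp (Primrec.const _) Primrec.list_length
  have hloc : Primrec fun w : List ℕ => 4 + 2 * (S.checker w).letters :=
    Primrec.nat_add.comp (Primrec.const 4) (Primrec.nat_mul.comp (Primrec.const 2) hl)
  have hacc : Primrec fun w : List ℕ =>
      1 :: 3 :: (List.range (S.checker w).letters).map fun a => 5 + 2 * a :=
    Primrec.list_cons.comp (Primrec.const 1) (Primrec.list_cons.comp (Primrec.const 3)
      (Primrec.list_map (Primrec.list_range.comp hl) (Primrec.nat_add.comp (Primrec.const 5)
        (Primrec.nat_mul.comp (Primrec.const 2) Primrec.snd))))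
  exact (Primrec.of_equiv_symm (e := AutomatonCode.equivProd)).comp
    (hl.pair ((Primrec.const 1).pair (hloc.pair ((Primrec.const 1).pair
      ((Primrec.const [0, 2, 3]).pair (hacc.pair (primrec_edges S)))))))

theorem primrec_initWord {Γ Λ : Type} [Fintype Γ] [Fintype Λ] [Inhabited Γ] [Inhabited Λ]
    {inp : ℕ → List Γ} (h : ∀ e : Γ → ℕ, Primrec fun n => (inp n).map e) :
    Primrec fun n => (initWord (inp n) : List (Cell Γ Λ)).map cellNum := by
  let e₁ : Γ → ℕ := fun s => cellNum (some (s, none) : Cell Γ Λ)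
  let e₂ : Γ → ℕ := fun s => cellNum (some (s, some default) : Cell Γ Λ)
  -- Wall, left blank, the cell under the head, and the rest; the defaults of `getD` are the numbers
  -- of blank cells, with the head in column `2` and without it further on.
  have hrow : ∀ n i, cellNum ((ZCfg.init (inp n) : ZCfg Γ Λ).row 2 i) =
      if i = 0 then cellNum (none : Cell Γ Λ) else if i = 1 then e₁ default else
        if i = 2 then ((inp n).map e₂).getD 0 (e₂ default) else
          ((inp n).map e₁).getD (i - 2) (e₁ default) := by
    intro n i
    have hget : ∀ (e : Γ → ℕ) (k : ℕ), ((inp n).map e).getD k (e default) = e ((inp n).getI k) := by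
      intro e k
      rw [List.getI_eq_getElem?_getD, List.getD_eq_getElem?_getD, List.getElem?_map]
      cases (inp n)[k]? <;> rfl
    rw [hget, hget, ZCfg.row]
    split_ifs with h0 h1 h2
    · rfl
    · subst h1
      simp [ZCfg.cell, ZCfg.init, e₁]
    · subst h2
      simp [ZCfg.cell, ZCfg.init, e₂]
    · have a1 : ¬ (i : ℤ) - (2 : ℕ) < 0 := by omega
      have a2 : (i : ℤ) - (2 : ℕ) ≠ 0 := by omega
      have a3 : ((i : ℤ) - (2 : ℕ)).toNat = i - 2 := by omega
      simp only [ZCfg.cell, ZCfg.init, a1, a2, a3, if_false, e₁]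
  have hlen : Primrec fun n => (inp n).length :=
    (Primrec.list_length.comp (h e₁)).of_eq fun n => by simp
  simp only [initWord, List.map_map, Function.comp_def, hrow]
  refine Primrec.list_map (Primrec.list_range.comp
    (Primrec.nat_add.comp hlen (Primrec.const 4))) ?_
  refine Primrec.ite (Primrec.eq.comp Primrec.snd (Primrec.const 0)) (Primrec.const _)
    (Primrec.ite (Primrec.eq.comp Primrec.snd (Primrec.const 1)) (Primrec.const _)
    (Primrec.ite (Primrec.eq.comp Primrec.snd (Primrec.const 2)) ?_ ?_))
  · exact (Primrec.list_getD _).comp ((h e₂).comp Primrec.fst) (Primrec.const 0)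
  · exact (Primrec.list_getD _).comp ((h e₁).comp Primrec.fst)
      (Primrec.nat_sub.comp Primrec.snd (Primrec.const 2))

end Primitive

end TimedAutomata

/-- No algorithm decides, given a one-clock timed visibly one-counter automaton, whether it accepts
every timed word over its input alphabet. -/
theorem mainTheorem3 :
    ¬ ∃ decider : TimedAutomata.AutomatonCode → Bool,
      Computable decider ∧
      ∀ c : TimedAutomata.AutomatonCode,
        c.toAutomaton.IsOneClock → c.toAutomaton.IsOneCounter → c.toAutomaton.IsVisibly →
          (decider c = true ↔ c.toAutomaton.IsUniversal) := by
  rintro ⟨decider, hdec, h⟩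
  obtain ⟨Γ, Λ, _, _, _, _, M, inp, hinp, hM⟩ := TimedAutomata.exists_undecidable_machine
  let code : ℕ → TimedAutomata.AutomatonCode := fun n => ((TimedAutomata.tileSystem M).checker
    ((TimedAutomata.initWord (inp n) : List (TimedAutomata.Cell Γ Λ)).map
      TimedAutomata.cellNum)).code
  have hcode : Computable code :=
    ((TimedAutomata.primrec_code (TimedAutomata.tileSystem M)).comp
      (TimedAutomata.primrec_initWord hinp)).to_comp
  -- Negating the supposed decider on the computed automata would decide halting.
  refine hM (ComputablePred.of_eq (ComputablePred.computable_iff.2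
    ⟨fun n => !decider (code n), Primrec.not.to_comp.comp (hdec.comp hcode), rfl⟩) fun n => ?_)
  rw [← TimedAutomata.not_isUniversal_iff_halts (inp n), ← h (code n)
    TimedAutomata.Checker.isOneClock TimedAutomata.Checker.isOneCounter
    TimedAutomata.Checker.isVisibly]
  simp
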